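/- **Setting.** Let $n,m,T,k\ge 1$. For $t\le T$ let $\varXi_t\subseteq\mathbb R^{p_t}$, and consider matrices and vectors depending on a parameter: $Q_t(\xi)\in\mathbb R^{n\times n}$, $R_t(\xi)\in\mathbb R^{m\times m}$, $A_t(\xi)\in\mathbb R^{n\times n}$, $B_t(\xi)\in\mathbb R^{n\times m}$, $w_t(\xi)\in\mathbb R^n$ ($t<T$), $\bar x_t(\xi)\in\mathbb R^n$ ($t\le T$), and $P_T(\xi)\in\mathbb R^{n\times n}$. Put $F_T(y;\xi)=(y-\bar x_T(\xi))^\top P_T(\xi)(y-\bar x_T(\xi))$ and let $\mathbb I(y;\zeta)=0$ if $y=\zeta$, $+\infty$ otherwise. For $t_1<t_2$, $\psi_{t_1}^{t_2}(z,\xi_{t_1:t_2-1},\zeta;F)$ denotes the minimizer $(y_{t_1:t_2},v_{t_1:t_2-1})$ of $$\sum_{t=t_1}^{t_2-1}\Big((y_t-\bar x_t(\xi_t))^\top Q_t(\xi_t)(y_t-\bar x_t(\xi_t))+v_t^\top R_t(\xi_t)v_t\Big)+F(y_{t_2};\zeta)$$ subject to $y_{t_1}=z$ and $y_{t+1}=A_t(\xi_t)y_t+B_t(\xi_t)v_t+w_t(\xi_t)$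 for $t_1\le t<t_2$. Norms are Euclidean norms and the induced matrix norms; $\mathcal B(x,r)$ is the closed ball. **Assumption.** There are constants $\mu,\sigma>0$, $\ell,a,b,D_w,D_{\bar x}$, and Lipschitz constants $L_A,L_B,L_Q,L_R,L_P,L_{\bar x},L_w\ge0$ such that for all relevant $t$ and all $\xi_t\in\varXi_t$: $\mu I\preceq Q_t(\xi_t),R_t(\xi_t),P_T(\xi_T)\preceq\ell I$; $\|w_t(\xi_t)\|\le D_w$, $\|\bar x_t(\xi_t)\|\le D_{\bar x}$, $\|A_t(\xi_t)\|\le a$, $\|B_t(\xi_t)\|\le b$; the maps $A_t,B_t,Q_t,R_t,P_T,\bar x_t,w_t$ are Lipschitz on $\varXi_t$ with the respective constants. For $t<t'$ let $N_t^{t'-1}(\xi_{t:t'-1})$ be the matrix of the linear map $$(y_t,v_t,\dots,v_{t'-1},y_{t'})\mapsto\big(y_t,\;y_{t+1}-A_t(\xi_t)y_t-B_t(\xi_t)v_t,\;\dots,\;y_{t'}-A_{t'-1}(\xi_{t'-1})y_{t'-1}-B_{t'-1}(\xi_{t'-1})v_{t'-1}\big),$$ and $\hat N_t^{t'-1}$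 the matrix obtained by deleting the columns of $y_{t'}$. Then, for all admissible parameters, $\sigma_{\min}(N_t^{T-1}(\xi_{t:T-1}))\ge\sigma$ for every $t<T$, and $\sigma_{\min}(\hat N_t^{t+k-1}(\xi_{t:t+k-1}))\ge\sigma$ for every $t<T-k$, where $\sigma_{\min}(N)$ is the square root of the smallest eigenvalue of $NN^\top$. **Constants.** $$\underline\sigma_H=\min(\mu,1)\,\sigma\sqrt{\frac{\mu}{2\mu\ell+\ell(a+b+1)^2}},\qquad \overline\sigma_H=\sqrt2(\ell+a+b+1),\qquad \lambda_2=\Big(\frac{\overline\sigma_H-\underline\sigma_H}{\overline\sigma_H+\underline\sigma_H}\Big)^{1/2},$$ $$C_2=\frac{4(\ell+1+a+b)}{\underline\sigma_H^2\lambda_2},\qquad C_2'=C_2^2\Big(\max\{L_Q+L_R,L_P\}+\frac2{\lambda_2}(L_A+L_B)\Big),$$ $$H_2=C_2'\Big(\frac{2(\ell D_{\bar x}+D_w)}{1-\lambda_2}+R+D_{x^*}+1\Big)+C_2\big(L_w+\ell L_{\bar x}+D_{\bar x}L_Q+1\big).$$ **Theorem.** Let $\xi^*_t\in\varXi_t$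 ($t\le T$) be the true parameters and $x_0\in\mathbb R^n$. Then the offline optimal trajectory $(x^*,u^*)=\psi_0^T(x_0,\xi^*_{0:T-1},\xi^*_T;F_T)$ exists and is unique, and $0<\lambda_2<1$. Let $\|x_t^*\|\le D_{x^*}$ for all $t\le T$ and let $R>0$ be arbitrary. Then $H_2\ge1$, and with $q_1(t)=H_2\lambda_2^{2t}$, $q_2(t)=q_3(t)=H_2\lambda_2^t$ (which tend to $0$ and are summable) the following holds; all minimizers that occur exist and are unique. 1. For $t<T-k$, $z\in\mathcal B(x_t^*,R)$, $\xi_\tau\in\varXi_\tau$ ($t\le\tau<t+k$), $\zeta,\zeta'\in\mathcal B(x^*_{t+k},R)$, $$\big\|\psi_t^{t+k}(z,\xi_{t:t+k-1},\zeta;\mathbb I)_{v_t}-\psi_t^{t+k}(z,\xi^*_{t:t+k-1},\zeta';\mathbb I)_{v_t}\big\|\le\Big(\sum_{i=0}^kq_1(i)\delta_{t+i}\Big)\|z\|+\sum_{i=0}^kq_2(i)\delta_{t+i},$$ where $\delta_\tau=\|\xi_\tau-\xi_\tau^*\|$ for $\tau<t+k$ and $\delta_{t+k}=\|\zeta-\zeta'\|$.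 2. For $T-k\le t<T$, $z\in\mathcal B(x_t^*,R)$, $\xi_\tau\in\varXi_\tau$ ($t\le\tau\le T$), with $\delta_\tau=\|\xi_\tau-\xi^*_\tau\|$, $$\big\|\psi_t^{T}(z,\xi_{t:T-1},\xi_T;F_T)_{v_t}-\psi_t^{T}(z,\xi^*_{t:T-1},\xi^*_T;F_T)_{v_t}\big\|\le\Big(\sum_{i=0}^{T-t}q_1(i)\delta_{t+i}\Big)\|z\|+\sum_{i=0}^{T-t}q_2(i)\delta_{t+i}.$$ 3. For $z,z'\in\mathcal B(x_t^*,R)$, the minimizers with initial states $z$ and $z'$ and parameters $\xi^*$ satisfy $\|y_\tau-y'_\tau\|\le q_3(\tau-t)\|z-z'\|$ and $\|v_\tau-v'_\tau\|\le q_3(\tau-t)\|z-z'\|$ for all states and inputs in the window, both for $\psi_t^T(\cdot,\xi^*_{t:T-1},\xi^*_T;F_T)$ with $t<T$ and for $\psi_t^{t+k}(\cdot,\xi^*_{t:t+k-1},\zeta;\mathbb I)$ with $t<T-k$ and $\zeta\in\mathcal B(x^*_{t+k},R)$. -/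

import Mathlib

open scoped Matrix.Norms.L2Operator

noncomputable section

namespace PredictiveControl

/-- Euclidean space `ℝ^d`: states (`d = n`), control inputs (`d = m`), and the uncertainty
parameters at time `t` (`d = p t`). -/
abbrev Vec (d : ℕ) : Type := EuclideanSpace ℝ (Fin d)

/-! ### The general finite-horizon control problem and the FTOCP -/

/-- A finite-horizon discrete-time control problem with horizon `T`: stage costs `f`, dynamics `g`,
stage constraints `s ≤ 0`, terminal cost `F`, all parameterized by `ξ_t`, and the sets `Xi t` of
admissible parameters. -/
structure ControlProblem (n m : ℕ) (p : ℕ → ℕ) (T : ℕ) where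
  f : (t : ℕ) → Vec n → Vec m → Vec (p t) → ℝ
  g : (t : ℕ) → Vec n → Vec m → Vec (p t) → Vec n
  /-- number of scalar constraints at time `t` -/
  c : ℕ → ℕ
  s : (t : ℕ) → Vec n → Vec m → Vec (p t) → Fin (c t) → ℝ
  F : Vec n → Vec (p T) → WithTop ℝ
  Xi : (t : ℕ) → Set (Vec (p t))

/-- Trajectories over a window of `L` steps: states `y_{t₁}, …, y_{t₁+L}` and
inputs `v_{t₁}, …, v_{t₁+L-1}`, both indexed from `0`. -/
abbrev Traj (n m L : ℕ) : Type := (Fin (L + 1) → Vec n) × (Fin L → Vec m)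

/-- The indicator terminal cost with target `ζ`. -/
def indicatorCost {n : ℕ} (y ζ : Vec n) : WithTop ℝ :=
  open scoped Classical in if y = ζ then 0 else ⊤

namespace ControlProblem

variable {n m : ℕ} {p : ℕ → ℕ} {T : ℕ}

/-- Feasibility for the FTOCP on `[t₁, t₁ + L]` with initial state `z` and parameters `ξ`
(only `ξ_{t₁}, …, ξ_{t₁+L-1}` are used). -/
def Feasible (S : ControlProblem n m p T) (t₁ L : ℕ) (z : Vec n) (ξ : (t : ℕ) → Vec (p t))
    (q : Traj n m L) : Prop :=
  q.1 0 = z ∧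
  ∀ i : Fin L,
    q.1 i.succ = S.g (t₁ + i) (q.1 i.castSucc) (q.2 i) (ξ (t₁ + i)) ∧
    S.s (t₁ + i) (q.1 i.castSucc) (q.2 i) (ξ (t₁ + i)) ≤ 0

/-- The objective of the FTOCP on `[t₁, t₁ + L]`; `G` is the terminal cost with its parameter
already plugged in. -/
def cost (S : ControlProblem n m p T) (t₁ L : ℕ) (ξ : (t : ℕ) → Vec (p t))
    (G : Vec n → WithTop ℝ) (q : Traj n m L) : WithTop ℝ :=
  ((∑ i : Fin L, S.f (t₁ + i) (q.1 i.castSucc) (q.2 i) (ξ (t₁ + i)) : ℝ) : WithTop ℝ)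
    + G (q.1 (Fin.last L))

/-- `q` is an optimal solution of the FTOCP on `[t₁, t₁ + L]` (with finite optimal value). -/
def IsOptimal (S : ControlProblem n m p T) (t₁ L : ℕ) (z : Vec n) (ξ : (t : ℕ) → Vec (p t))
    (G : Vec n → WithTop ℝ) (q : Traj n m L) : Prop :=
  S.Feasible t₁ L z ξ q ∧ S.cost t₁ L ξ G q < ⊤ ∧
  ∀ q' : Traj n m L, S.Feasible t₁ L z ξ q' → S.cost t₁ L ξ G q ≤ S.cost t₁ L ξ G q'

/-- Perturbation of the initial state, with fixed parameters, on `[t₁, t₁ + L]`: both problems have a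
unique optimal solution, and states and inputs `i` steps after `t₁` differ by at most
`q₃ i * ‖z - z'‖`. -/
def InitialStateBound (S : ControlProblem n m p T) (q₃ : ℕ → ℝ) (t₁ L : ℕ) (z z' : Vec n)
    (ξ : (t : ℕ) → Vec (p t)) (G : Vec n → WithTop ℝ) : Prop :=
  (∃! q, S.IsOptimal t₁ L z ξ G q) ∧ (∃! q', S.IsOptimal t₁ L z' ξ G q') ∧
  ∀ q q', S.IsOptimal t₁ L z ξ G q → S.IsOptimal t₁ L z' ξ G q' →
    (∀ i : Fin (L + 1), ‖q.1 i - q'.1 i‖ ≤ q₃ i * ‖z - z'‖) ∧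
    (∀ i : Fin L, ‖q.2 i - q'.2 i‖ ≤ q₃ i * ‖z - z'‖)

/-- Perturbation of the parameters, with fixed initial state, on `[t₁, t₁ + L]`: both problems have a
unique optimal solution, and the first inputs differ by at most
`(∑_{i ≤ L} q₁ i * δ i) * ‖z‖ + ∑_{i ≤ L} q₂ i * δ i`. Here `δ i = ‖ξ_{t₁+i} - ξ'_{t₁+i}‖` for
`i < L`, and `δ L = δT` is the distance of the two terminal parameters, which are plugged into
`G` and `G'`. -/
def ParameterBound (S : ControlProblem n m p T) (q₁ q₂ : ℕ → ℝ) (t₁ L : ℕ) (hL : 0 < L)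
    (z : Vec n) (ξ ξ' : (t : ℕ) → Vec (p t)) (G G' : Vec n → WithTop ℝ) (δT : ℝ) : Prop :=
  (∃! q, S.IsOptimal t₁ L z ξ G q) ∧ (∃! q', S.IsOptimal t₁ L z ξ' G' q') ∧
  ∀ q q', S.IsOptimal t₁ L z ξ G q → S.IsOptimal t₁ L z ξ' G' q' →
    ‖q.2 ⟨0, hL⟩ - q'.2 ⟨0, hL⟩‖ ≤
      (∑ i ∈ Finset.range L, q₁ i * ‖ξ (t₁ + i) - ξ' (t₁ + i)‖ + q₁ L * δT) * ‖z‖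
      + (∑ i ∈ Finset.range L, q₂ i * ‖ξ (t₁ + i) - ξ' (t₁ + i)‖ + q₂ L * δT)

/-- The perturbation bounds required for `MPC_k` in the ball of radius `R` around the offline optimal
states `xs`, for the true parameters `ξs` and the decay functions `q₁, q₂, q₃`. -/
structure PerturbationProperty (S : ControlProblem n m p T) (k : ℕ) (hk : 0 < k)
    (ξs : (t : ℕ) → Vec (p t)) (xs : ℕ → Vec n) (R : ℝ) (q₁ q₂ q₃ : ℕ → ℝ) : Prop where
  tendsto₁ : Filter.Tendsto q₁ Filter.atTop (nhds 0)
  tendsto₂ : Filter.Tendsto q₂ Filter.atTop (nhds 0)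
  sum₁ : ∃ C₁ : ℝ, 1 ≤ C₁ ∧ Summable q₁ ∧ ∑' t, q₁ t ≤ C₁
  sum₂ : ∃ C₂ : ℝ, 1 ≤ C₂ ∧ Summable q₂ ∧ ∑' t, q₂ t ≤ C₂
  sum₃ : ∃ C₃ : ℝ, 1 ≤ C₃ ∧ Summable q₃ ∧ ∑' t, q₃ t ≤ C₃
  /-- `t < T - k`: window `[t, t + k]`, indicator terminal costs with targets `ζ`, `ζ'`. -/
  parameters_indicator : ∀ t : ℕ, t + k < T →
    ∀ z ∈ Metric.closedBall (xs t) R,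
    ∀ ξ : (t : ℕ) → Vec (p t), (∀ τ, t ≤ τ → τ < t + k → ξ τ ∈ S.Xi τ) →
    ∀ ζ ∈ Metric.closedBall (xs (t + k)) R, ∀ ζ' ∈ Metric.closedBall (xs (t + k)) R,
      S.ParameterBound q₁ q₂ t k hk z ξ ξs
        (fun y => indicatorCost y ζ) (fun y => indicatorCost y ζ') ‖ζ - ζ'‖
  /-- `T - k ≤ t < T`: window `[t, T]` (of length `L = T - t ≤ k`), terminal cost `F_T`. -/
  parameters_terminal : ∀ t L : ℕ, t + L = T → ∀ hL : 0 < L, L ≤ k →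
    ∀ z ∈ Metric.closedBall (xs t) R,
    ∀ ξ : (t : ℕ) → Vec (p t), (∀ τ, t ≤ τ → τ ≤ T → ξ τ ∈ S.Xi τ) →
      S.ParameterBound q₁ q₂ t L hL z ξ ξs
        (fun y => S.F y (ξ T)) (fun y => S.F y (ξs T)) ‖ξ T - ξs T‖
  /-- Perturbed initial state, window `[t, t + k]`, true parameters, common target `ζ`. -/
  initial_indicator : ∀ t : ℕ, t + k < T →
    ∀ z ∈ Metric.closedBall (xs t) R, ∀ z' ∈ Metric.closedBall (xs t) R,
    ∀ ζ ∈ Metric.closedBall (xs (t + k)) R,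
      S.InitialStateBound q₃ t k z z' ξs (fun y => indicatorCost y ζ)
  /-- Perturbed initial state, window `[t, T]` for any `t < T`, true parameters. -/
  initial_terminal : ∀ t L : ℕ, t + L = T → 0 < L →
    ∀ z ∈ Metric.closedBall (xs t) R, ∀ z' ∈ Metric.closedBall (xs t) R,
      S.InitialStateBound q₃ t L z z' ξs (fun y => S.F y (ξs T))

end ControlProblem

/-! ### Unconstrained LTV systems with quadratic tracking costs -/

/-- Multiplication of a Euclidean vector by a matrix. -/
def mulVec {d e : ℕ} (M : Matrix (Fin d) (Fin e) ℝ) (x : Vec e) : Vec d :=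
  WithLp.toLp 2 (M.mulVec x.ofLp)

/-- The quadratic form `xᵀ M x`. -/
def quad {d : ℕ} (M : Matrix (Fin d) (Fin d) ℝ) (x : Vec d) : ℝ :=
  x.ofLp ⬝ᵥ M.mulVec x.ofLp

/-- The data of an unconstrained LTV problem: cost matrices `Q_t, R_t, P_T`, tracked states `x̄_t`,
dynamics `A_t, B_t, w_t`, as functions of the parameter, and the parameter sets. -/
structure LTV (n m : ℕ) (p : ℕ → ℕ) (T : ℕ) where
  Q : (t : ℕ) → Vec (p t) → Matrix (Fin n) (Fin n) ℝ
  R : (t : ℕ) → Vec (p t) → Matrix (Fin m) (Fin m) ℝ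
  P : Vec (p T) → Matrix (Fin n) (Fin n) ℝ
  xbar : (t : ℕ) → Vec (p t) → Vec n
  A : (t : ℕ) → Vec (p t) → Matrix (Fin n) (Fin n) ℝ
  B : (t : ℕ) → Vec (p t) → Matrix (Fin n) (Fin m) ℝ
  w : (t : ℕ) → Vec (p t) → Vec n
  Xi : (t : ℕ) → Set (Vec (p t))

/-- The smallest singular value of a matrix, counted over its rows: the smallest square root of an
eigenvalue of `N Nᵀ`. It is positive if and only if `N` has full row rank. -/
def sigmaMin {ι κ : Type} [Fintype ι] [DecidableEq ι] [Fintype κ] (N : Matrix ι κ ℝ) : ℝ :=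
  ⨅ i, √((Matrix.isHermitian_mul_conjTranspose_self N).eigenvalues i)

/-- The constants appearing in the assumptions. -/
structure Consts where
  (μ ℓ a b σ Dw Dxbar LA LB LQ LR LP Lxbar Lw : ℝ)

namespace LTV

variable {n m : ℕ} {p : ℕ → ℕ} {T : ℕ}

/-- The control problem defined by the LTV data. -/
def toProblem (D : LTV n m p T) : ControlProblem n m p T where
  f t x u ξ := quad (D.Q t ξ) (x - D.xbar t ξ) + quad (D.R t ξ) u
  g t x u ξ := mulVec (D.A t ξ) x + mulVec (D.B t ξ) u + D.w t ξ
  c _ := 0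
  s _ _ _ _ := 0
  F x ξ := ((quad (D.P ξ) (x - D.xbar T ξ) : ℝ) : WithTop ℝ)
  Xi := D.Xi

/-- The dynamics matrix of the window of `L` steps starting at `t`. Block rows are
`0, …, L`: row `0` reads `y_t`, row `i + 1` reads `y_{t+i+1} - A_{t+i} y_{t+i} - B_{t+i} v_{t+i}`.
The columns are the first `c` states (`Sum.inl`) and the inputs `v_t, …, v_{t+L-1}` (`Sum.inr`). -/
def dynMatrix (D : LTV n m p T) (t L c : ℕ) (ξ : (t : ℕ) → Vec (p t)) :
    Matrix (Fin (L + 1) × Fin n) ((Fin c × Fin n) ⊕ (Fin L × Fin m)) ℝ :=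
  Matrix.of fun r col =>
    match col with
    | Sum.inl j =>
        if (j.1 : ℕ) = r.1 then (if j.2 = r.2 then 1 else 0)
        else if (j.1 : ℕ) + 1 = r.1 then -(D.A (t + j.1) (ξ (t + j.1)) r.2 j.2)
        else 0
    | Sum.inr j =>
        if (j.1 : ℕ) + 1 = r.1 then -(D.B (t + j.1) (ξ (t + j.1)) r.2 j.2) else 0

/-- `N_t^{t+L-1}`: all states `y_t, …, y_{t+L}` are free. -/
def N (D : LTV n m p T) (t L : ℕ) (ξ : (t : ℕ) → Vec (p t)) :
    Matrix (Fin (L + 1) × Fin n) ((Fin (L + 1) × Fin n) ⊕ (Fin L × Fin m)) ℝ :=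
  D.dynMatrix t L (L + 1) ξ

/-- `N̂_t^{t+L-1}`: the column of the last state `y_{t+L}` is removed. -/
def NHat (D : LTV n m p T) (t L : ℕ) (ξ : (t : ℕ) → Vec (p t)) :
    Matrix (Fin (L + 1) × Fin n) ((Fin L × Fin n) ⊕ (Fin L × Fin m)) ℝ :=
  D.dynMatrix t L L ξ

/-- The standing assumption on costs, controllability and predicted quantities. -/
structure Assumption (D : LTV n m p T) (k : ℕ) (K : Consts) : Prop where
  μ_pos : 0 < K.μ
  σ_pos : 0 < K.σ
  LA_nonneg : 0 ≤ K.LA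
  LB_nonneg : 0 ≤ K.LB
  LQ_nonneg : 0 ≤ K.LQ
  LR_nonneg : 0 ≤ K.LR
  LP_nonneg : 0 ≤ K.LP
  Lxbar_nonneg : 0 ≤ K.Lxbar
  Lw_nonneg : 0 ≤ K.Lw
  -- costs
  Q_lower : ∀ t < T, ∀ ξ ∈ D.Xi t, (D.Q t ξ - K.μ • 1).PosSemidef
  Q_upper : ∀ t < T, ∀ ξ ∈ D.Xi t, (K.ℓ • 1 - D.Q t ξ).PosSemidef
  R_lower : ∀ t < T, ∀ ξ ∈ D.Xi t, (D.R t ξ - K.μ • 1).PosSemidef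
  R_upper : ∀ t < T, ∀ ξ ∈ D.Xi t, (K.ℓ • 1 - D.R t ξ).PosSemidef
  P_lower : ∀ ξ ∈ D.Xi T, (D.P ξ - K.μ • 1).PosSemidef
  P_upper : ∀ ξ ∈ D.Xi T, (K.ℓ • 1 - D.P ξ).PosSemidef
  -- stability and controllability of every possible system
  N_sigma : ∀ t L : ℕ, t + L = T → 0 < L → ∀ ξ : (t : ℕ) → Vec (p t),
    (∀ τ, t ≤ τ → τ < T → ξ τ ∈ D.Xi τ) → K.σ ≤ sigmaMin (D.N t L ξ)
  NHat_sigma : ∀ t : ℕ, t + k < T → ∀ ξ : (t : ℕ) → Vec (p t),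
    (∀ τ, t ≤ τ → τ < t + k → ξ τ ∈ D.Xi τ) → K.σ ≤ sigmaMin (D.NHat t k ξ)
  -- bounds on the predicted quantities
  w_bound : ∀ t < T, ∀ ξ ∈ D.Xi t, ‖D.w t ξ‖ ≤ K.Dw
  xbar_bound : ∀ t ≤ T, ∀ ξ ∈ D.Xi t, ‖D.xbar t ξ‖ ≤ K.Dxbar
  A_bound : ∀ t < T, ∀ ξ ∈ D.Xi t, ‖D.A t ξ‖ ≤ K.a
  B_bound : ∀ t < T, ∀ ξ ∈ D.Xi t, ‖D.B t ξ‖ ≤ K.b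
  -- Lipschitz continuity in the parameter
  A_lip : ∀ t < T, ∀ ξ ∈ D.Xi t, ∀ ξ' ∈ D.Xi t, ‖D.A t ξ - D.A t ξ'‖ ≤ K.LA * ‖ξ - ξ'‖
  B_lip : ∀ t < T, ∀ ξ ∈ D.Xi t, ∀ ξ' ∈ D.Xi t, ‖D.B t ξ - D.B t ξ'‖ ≤ K.LB * ‖ξ - ξ'‖
  Q_lip : ∀ t < T, ∀ ξ ∈ D.Xi t, ∀ ξ' ∈ D.Xi t, ‖D.Q t ξ - D.Q t ξ'‖ ≤ K.LQ * ‖ξ - ξ'‖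
  R_lip : ∀ t < T, ∀ ξ ∈ D.Xi t, ∀ ξ' ∈ D.Xi t, ‖D.R t ξ - D.R t ξ'‖ ≤ K.LR * ‖ξ - ξ'‖
  P_lip : ∀ ξ ∈ D.Xi T, ∀ ξ' ∈ D.Xi T, ‖D.P ξ - D.P ξ'‖ ≤ K.LP * ‖ξ - ξ'‖
  xbar_lip : ∀ t ≤ T, ∀ ξ ∈ D.Xi t, ∀ ξ' ∈ D.Xi t,
    ‖D.xbar t ξ - D.xbar t ξ'‖ ≤ K.Lxbar * ‖ξ - ξ'‖
  w_lip : ∀ t < T, ∀ ξ ∈ D.Xi t, ∀ ξ' ∈ D.Xi t, ‖D.w t ξ - D.w t ξ'‖ ≤ K.Lw * ‖ξ - ξ'‖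

end LTV

/-! ### The explicit constants -/

namespace Consts

/-- The constant `σ_H` with lower bar. -/
def sigmaHLow (K : Consts) : ℝ :=
  min K.μ 1 * K.σ * √(K.μ / (2 * K.μ * K.ℓ + K.ℓ * (K.a + K.b + 1) ^ 2))

/-- The constant `σ_H` with upper bar. -/
def sigmaHHigh (K : Consts) : ℝ := √2 * (K.ℓ + K.a + K.b + 1)

/-- The decay rate `λ₂`. -/
def lam2 (K : Consts) : ℝ :=
  √((K.sigmaHHigh - K.sigmaHLow) / (K.sigmaHHigh + K.sigmaHLow))

/-- The constant `C₂`. -/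
def C2 (K : Consts) : ℝ := 4 * (K.ℓ + 1 + K.a + K.b) / (K.sigmaHLow ^ 2 * K.lam2)

/-- The constant `C₂'`. -/
def C2' (K : Consts) : ℝ :=
  K.C2 ^ 2 * (max (K.LQ + K.LR) K.LP + 2 / K.lam2 * (K.LA + K.LB))

/-- The constant `H₂`, depending also on the radius `R` and the bound `Dxs` on the offline optimal
states. -/
def H2 (K : Consts) (R Dxs : ℝ) : ℝ :=
  K.C2' * (2 * (K.ℓ * K.Dxbar + K.Dw) / (1 - K.lam2) + R + Dxs + 1)
    + K.C2 * (K.Lw + K.ℓ * K.Lxbar + K.Dxbar * K.LQ + 1)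

end Consts

end PredictiveControl

end

noncomputable section

namespace PredictiveControl

open Finset
open scoped InnerProductSpace InnerProduct

/-! ### Elementary inequalities -/

lemma sum_mul_le_of_sum_sq_le {ι : Type*} {s : Finset ι} {q r : ι → ℝ} {X Y : ℝ}
    (hX : 0 ≤ X) (hY : 0 ≤ Y) (hq : ∑ i ∈ s, q i ^ 2 ≤ X ^ 2) (hr : ∑ i ∈ s, r i ^ 2 ≤ Y ^ 2) :
    ∑ i ∈ s, q i * r i ≤ X * Y := by
  refine (Real.sum_mul_le_sqrt_mul_sqrt s q r).trans ?_
  exact mul_le_mul (Real.sqrt_le_iff.2 ⟨hX, hq⟩) (Real.sqrt_le_iff.2 ⟨hY, hr⟩)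
    (Real.sqrt_nonneg _) hX

lemma sum_sq_add_le_of_sum_sq_le {ι : Type*} {s : Finset ι} {q r : ι → ℝ} {X Y : ℝ}
    (hX : 0 ≤ X) (hY : 0 ≤ Y) (hq : ∑ i ∈ s, q i ^ 2 ≤ X ^ 2) (hr : ∑ i ∈ s, r i ^ 2 ≤ Y ^ 2) :
    ∑ i ∈ s, (q i + r i) ^ 2 ≤ (X + Y) ^ 2 := by
  have h := sum_mul_le_of_sum_sq_le hX hY hq hr
  have e : ∑ i ∈ s, (q i + r i) ^ 2
      = ∑ i ∈ s, q i ^ 2 + 2 * ∑ i ∈ s, q i * r i + ∑ i ∈ s, r i ^ 2 := by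
    rw [mul_sum, ← sum_add_distrib, ← sum_add_distrib]
    exact sum_congr rfl fun i _ => by ring
  rw [e]
  nlinarith

lemma primal_dual_bounds {μ ℓ σ e X Λ F g d η₁ η₂ : ℝ} (hμ : 0 < μ) (hμℓ : μ ≤ ℓ) (hσ : 0 < σ)
    (he : 0 ≤ e) (hΛ : 0 ≤ Λ) (hF : 0 ≤ F) (hg : 0 ≤ g) (hη₂ : 0 ≤ η₂ * d)
    (h₁ : e ^ 2 ≤ X * F + g * Λ + η₂ * d * X * Λ)
    (h₂ : σ * Λ ≤ F + √ℓ * e + η₁ * d * Λ) (h₃ : μ * X ^ 2 ≤ e ^ 2)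
    (hd₁ : η₁ * d ≤ σ / 5) (hd₂ : η₂ * d * √ℓ ≤ 3 / 10 * (σ * √μ)) :
    X ≤ 3 / μ * F + 15 / 4 * (√ℓ / (√μ * σ)) * g ∧
    Λ ≤ 5 * (√ℓ / (√μ * σ)) * F + 75 / 16 * (ℓ / σ ^ 2) * g := by
  obtain ⟨sm, hsm⟩ : ∃ sm, sm = √μ := ⟨_, rfl⟩
  obtain ⟨sl, hsl⟩ : ∃ sl, sl = √ℓ := ⟨_, rfl⟩
  have hm : 0 < sm := hsm ▸ Real.sqrt_pos.2 hμ
  have hml : sm ≤ sl := by rw [hsm, hsl]; exact Real.sqrt_le_sqrt hμℓ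
  have hl : 0 < sl := hm.trans_le hml
  have em : μ = sm ^ 2 := by rw [hsm, Real.sq_sqrt hμ.le]
  have el : ℓ = sl ^ 2 := by rw [hsl, Real.sq_sqrt (hμ.le.trans hμℓ)]
  rw [← hsl] at h₂ hd₂ ⊢
  rw [← hsm] at hd₂ ⊢
  clear hsm hsl
  subst em el
  have hXe : X ≤ e / sm := by
    rw [le_div_iff₀ hm]
    refine abs_le_of_sq_le_sq' ?_ he |>.2
    linarith [mul_pow X sm 2]
  have hΛe : Λ ≤ 5 / (4 * σ) * (F + sl * e) := by
    rw [div_mul_eq_mul_div, le_div_iff₀ (by positivity)]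
    nlinarith [mul_le_mul_of_nonneg_right hd₁ hΛ]
  obtain ⟨u, hu⟩ : ∃ u, u = F / sm := ⟨_, rfl⟩
  obtain ⟨w, hw⟩ : ∃ w, w = 5 * sl * g / (4 * σ) := ⟨_, rfl⟩
  have hu0 : 0 ≤ u := hu ▸ by positivity
  have hw0 : 0 ≤ w := hw ▸ by positivity
  have hFl : F / sl ≤ u := hu ▸ div_le_div_of_nonneg_left hF hm hml
  have t₁ : X * F ≤ u * e := by
    calc X * F ≤ e / sm * F := by gcongr
      _ = u * e := by rw [hu]; ring
  have t₂ : g * Λ ≤ w * (u + e) := by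
    calc g * Λ ≤ g * (5 / (4 * σ) * (F + sl * e)) := by gcongr
      _ = w * (F / sl + e) := by rw [hw]; field_simp
      _ ≤ w * (u + e) := by gcongr
  have t₃ : η₂ * d * X * Λ ≤ 3 / 8 * (e * (u + e)) := by
    calc η₂ * d * X * Λ ≤ η₂ * d * (e / sm) * (5 / (4 * σ) * (F + sl * e)) := by gcongr
      _ = η₂ * d * sl * (e / sm * (5 / (4 * σ) * (F / sl + e))) := by field_simp
      _ ≤ 3 / 10 * (σ * sm) * (e / sm * (5 / (4 * σ) * (F / sl + e))) :=
        mul_le_mul_of_nonneg_right hd₂ (by positivity)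
      _ = 3 / 8 * (e * (F / sl + e)) := by field_simp; ring
      _ ≤ 3 / 8 * (e * (u + e)) := by gcongr
  have he3 : e ≤ 3 * (u + w) := by
    by_contra! hc
    nlinarith [mul_nonneg hu0 hw0, mul_le_mul_of_nonneg_left hc.le hu0,
      mul_lt_mul_of_pos_left hc (lt_of_le_of_lt (by positivity) hc : (0 : ℝ) < e),
      mul_nonneg he hw0]
  constructor
  · calc X ≤ e / sm := hXe
      _ ≤ 3 * (u + w) / sm := by gcongr
      _ = 3 / sm ^ 2 * F + 15 / 4 * (sl / (sm * σ)) * g := by rw [hu, hw]; field_simp; ring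
  · have hFsl : F ≤ sl / sm * F := le_mul_of_one_le_left hF ((one_le_div hm).2 hml)
    calc Λ ≤ 5 / (4 * σ) * (F + sl * e) := hΛe
      _ ≤ 5 / (4 * σ) * (sl / sm * F + sl * (3 * (u + w))) := by gcongr
      _ = 5 * (sl / (sm * σ)) * F + 75 / 16 * (sl ^ 2 / σ ^ 2) * g := by
        rw [hu, hw]; field_simp; ring

/-! ### Linear-quadratic windows -/

/-- A linear-quadratic problem over `L` steps. The states `y_i` with `i < c` are free, and the
remaining ones are set to zero. -/
structure LQWindow (E U : Type*) [NormedAddCommGroup E] [InnerProductSpace ℝ E]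
    [NormedAddCommGroup U] [InnerProductSpace ℝ U] where
  L : ℕ
  c : ℕ
  A : ℕ → E →L[ℝ] E
  B : ℕ → U →L[ℝ] E
  Q : ℕ → E →L[ℝ] E
  R : ℕ → U →L[ℝ] U

namespace LQWindow

variable {E U : Type*} [NormedAddCommGroup E] [InnerProductSpace ℝ E] [CompleteSpace E]
  [NormedAddCommGroup U] [InnerProductSpace ℝ U] [CompleteSpace U]

/-- Uniform bounds on the data of a window, and the lower bound `σ` on the singular values of
its dynamics operator. -/
structure Bounded (W : LQWindow E U) (μ ℓ a b σ : ℝ) : Prop where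
  c_le : W.c ≤ W.L + 1
  le_c : W.L ≤ W.c
  c_pos : 0 < W.c
  a_nonneg : 0 ≤ a
  b_nonneg : 0 ≤ b
  Q_lower : ∀ i < W.c, ∀ y, μ * ‖y‖ ^ 2 ≤ ⟪y, W.Q i y⟫_ℝ
  Q_upper : ∀ i < W.c, ∀ y, ‖W.Q i y‖ ^ 2 ≤ ℓ * ⟪y, W.Q i y⟫_ℝ
  R_lower : ∀ i < W.L, ∀ v, μ * ‖v‖ ^ 2 ≤ ⟪v, W.R i v⟫_ℝ
  R_upper : ∀ i < W.L, ∀ v, ‖W.R i v‖ ^ 2 ≤ ℓ * ⟪v, W.R i v⟫_ℝ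
  A_le : ∀ i < W.L, ‖W.A i‖ ≤ a
  B_le : ∀ i < W.L, ‖W.B i‖ ≤ b
  adjoint_lower : ∀ p : ℕ → E, (∀ i, W.L < i → p i = 0) →
    σ ^ 2 * ∑ i ∈ range (W.L + 1), ‖p i‖ ^ 2 ≤
      ∑ i ∈ range W.c, ‖p i - ((W.A i)†) (p (i + 1))‖ ^ 2
        + ∑ i ∈ range W.L, ‖((W.B i)†) (p (i + 1))‖ ^ 2

/-- The Karush-Kuhn-Tucker system of a window with right-hand side `(f, h, g)`, in the states `y`,
the inputs `v` and the multipliers `p`. -/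
structure IsKKT (W : LQWindow E U) (f : ℕ → E) (h : ℕ → U) (g : ℕ → E)
    (y : ℕ → E) (v : ℕ → U) (p : ℕ → E) : Prop where
  y_zero : ∀ i, W.c ≤ i → y i = 0
  v_zero : ∀ i, W.L ≤ i → v i = 0
  p_zero : ∀ i, W.L < i → p i = 0
  state : ∀ i < W.c, W.Q i (y i) + (p i - ((W.A i)†) (p (i + 1))) = f i
  input : ∀ i < W.L, W.R i (v i) - ((W.B i)†) (p (i + 1)) = h i
  initial : y 0 = g 0
  dynamics : ∀ i < W.L, y (i + 1) - (W.A i (y i) + W.B i (v i)) = g (i + 1)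

lemma sum_range_eq_of_le {M : Type*} [AddCommMonoid M] {c L : ℕ} (h : c ≤ L) {F : ℕ → M}
    (hF : ∀ i, c ≤ i → F i = 0) : ∑ i ∈ range c, F i = ∑ i ∈ range L, F i :=
  sum_subset (range_mono h) fun i _ hi => hF i (by simpa using hi)

/-- The primal-dual estimate for the system obtained from the Karush-Kuhn-Tucker system by weighting
stage `i` with `ω i`, where `r i = ω (i + 1) / ω i`. -/
lemma Bounded.twisted_bounds {W : LQWindow E U} {μ ℓ a b σ : ℝ} (hW : W.Bounded μ ℓ a b σ)
    (hμ : 0 < μ) (hμℓ : μ ≤ ℓ) (hσ : 0 < σ) {η₁ η₂ : ℝ} (hη₁ : 0 ≤ η₁) (hη₂ : 0 ≤ η₂)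
    (hd₁ : η₁ * (a + b) ≤ σ / 5) (hd₂ : η₂ * (a + b) * √ℓ ≤ 3 / 10 * (σ * √μ))
    {r : ℕ → ℝ} (hr₁ : ∀ i < W.L, |(r i)⁻¹ - 1| ≤ η₁) (hr₂ : ∀ i < W.L, |(r i)⁻¹ - r i| ≤ η₂)
    {f : ℕ → E} {h : ℕ → U} {g : ℕ → E} {y : ℕ → E} {v : ℕ → U} {p : ℕ → E}
    (y_zero : ∀ i, W.c ≤ i → y i = 0) (p_zero : ∀ i, W.L < i → p i = 0)
    (state : ∀ i < W.c, W.Q i (y i) + (p i - (r i)⁻¹ • ((W.A i)†) (p (i + 1))) = f i)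
    (input : ∀ i < W.L, W.R i (v i) - (r i)⁻¹ • ((W.B i)†) (p (i + 1)) = h i)
    (initial : y 0 = g 0)
    (dynamics : ∀ i < W.L, y (i + 1) - r i • (W.A i (y i) + W.B i (v i)) = g (i + 1))
    {F G : ℝ} (hF0 : 0 ≤ F) (hG0 : 0 ≤ G)
    (hF : ∑ i ∈ range W.c, ‖f i‖ ^ 2 + ∑ i ∈ range W.L, ‖h i‖ ^ 2 ≤ F ^ 2)
    (hG : ∑ i ∈ range (W.L + 1), ‖g i‖ ^ 2 ≤ G ^ 2) :
    √(∑ i ∈ range W.c, ‖y i‖ ^ 2 + ∑ i ∈ range W.L, ‖v i‖ ^ 2)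
      ≤ 3 / μ * F + 15 / 4 * (√ℓ / (√μ * σ)) * G ∧
    √(∑ i ∈ range (W.L + 1), ‖p i‖ ^ 2) ≤ 5 * (√ℓ / (√μ * σ)) * F + 75 / 16 * (ℓ / σ ^ 2) * G := by
  have hℓ : 0 ≤ ℓ := hμ.le.trans hμℓ
  have hab : 0 ≤ a + b := add_nonneg hW.a_nonneg hW.b_nonneg
  obtain ⟨X, hX⟩ : ∃ X, X = √(∑ i ∈ range W.c, ‖y i‖ ^ 2 + ∑ i ∈ range W.L, ‖v i‖ ^ 2) := ⟨_, rfl⟩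
  obtain ⟨Λ, hΛ⟩ : ∃ Λ, Λ = √(∑ i ∈ range (W.L + 1), ‖p i‖ ^ 2) := ⟨_, rfl⟩
  have hX0 : 0 ≤ X := hX ▸ Real.sqrt_nonneg _
  have hΛ0 : 0 ≤ Λ := hΛ ▸ Real.sqrt_nonneg _
  have hX2 : X ^ 2 = ∑ i ∈ range W.c, ‖y i‖ ^ 2 + ∑ i ∈ range W.L, ‖v i‖ ^ 2 := by
    rw [hX, Real.sq_sqrt (by positivity)]
  have hΛ2 : Λ ^ 2 = ∑ i ∈ range (W.L + 1), ‖p i‖ ^ 2 := by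
    rw [hΛ, Real.sq_sqrt (by positivity)]
  have hQ0 : ∀ i ∈ range W.c, 0 ≤ ⟪y i, W.Q i (y i)⟫_ℝ := fun i hi =>
    le_trans (by positivity) (hW.Q_lower i (mem_range.1 hi) (y i))
  have hR0 : ∀ i ∈ range W.L, 0 ≤ ⟪v i, W.R i (v i)⟫_ℝ := fun i hi =>
    le_trans (by positivity) (hW.R_lower i (mem_range.1 hi) (v i))
  obtain ⟨e, he⟩ : ∃ e, e = √(∑ i ∈ range W.c, ⟪y i, W.Q i (y i)⟫_ℝ
    + ∑ i ∈ range W.L, ⟪v i, W.R i (v i)⟫_ℝ) := ⟨_, rfl⟩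
  have he0 : 0 ≤ e := he ▸ Real.sqrt_nonneg _
  have he2 : e ^ 2 = ∑ i ∈ range W.c, ⟪y i, W.Q i (y i)⟫_ℝ
      + ∑ i ∈ range W.L, ⟪v i, W.R i (v i)⟫_ℝ := by
    rw [he, Real.sq_sqrt (add_nonneg (sum_nonneg hQ0) (sum_nonneg hR0))]
  have hp_shift : ∑ i ∈ range W.L, ‖p (i + 1)‖ ^ 2 ≤ Λ ^ 2 := by
    rw [hΛ2, sum_range_succ']
    exact le_add_of_nonneg_right (sq_nonneg _)
  have hyL : ∑ i ∈ range W.L, ‖y i‖ ^ 2 ≤ X ^ 2 := by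
    rw [hX2]
    exact (sum_le_sum_of_subset_of_nonneg (range_mono hW.le_c) fun _ _ _ => sq_nonneg _).trans
      (le_add_of_nonneg_right (sum_nonneg fun _ _ => sq_nonneg _))
  have hvL : ∑ i ∈ range W.L, ‖v i‖ ^ 2 ≤ X ^ 2 := by
    rw [hX2]
    exact le_add_of_nonneg_left (sum_nonneg fun _ _ => sq_nonneg _)
  rw [← hX, ← hΛ]
  refine primal_dual_bounds hμ hμℓ hσ he0 hΛ0 hF0 hG0 (mul_nonneg hη₂ hab) ?_ ?_ ?_ hd₁ hd₂
  · have e₁ : ∑ i ∈ range W.c, ⟪y i, W.Q i (y i)⟫_ℝ =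
        ∑ i ∈ range W.c, ⟪y i, f i⟫_ℝ - ∑ i ∈ range (W.L + 1), ⟪y i, p i⟫_ℝ
          + ∑ i ∈ range W.L, (r i)⁻¹ * ⟪W.A i (y i), p (i + 1)⟫_ℝ := by
      have t₁ : ∑ i ∈ range (W.L + 1), ⟪y i, p i⟫_ℝ = ∑ i ∈ range W.c, ⟪y i, p i⟫_ℝ :=
        (sum_range_eq_of_le hW.c_le fun i hi => by rw [y_zero i hi, inner_zero_left]).symm
      have t₂ : ∑ i ∈ range W.L, (r i)⁻¹ * ⟪W.A i (y i), p (i + 1)⟫_ℝ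
          = ∑ i ∈ range W.c, (r i)⁻¹ * ⟪W.A i (y i), p (i + 1)⟫_ℝ :=
        sum_range_eq_of_le hW.le_c fun i hi => by
          rw [p_zero (i + 1) (by omega), inner_zero_right, mul_zero]
      rw [t₁, t₂, ← sum_sub_distrib, ← sum_add_distrib]
      refine sum_congr rfl fun i hi => ?_
      rw [← state i (mem_range.1 hi), inner_add_right, inner_sub_right, inner_smul_right,
        ContinuousLinearMap.adjoint_inner_right]
      ring
    have e₂ : ∑ i ∈ range W.L, ⟪v i, W.R i (v i)⟫_ℝ =
        ∑ i ∈ range W.L, ⟪v i, h i⟫_ℝ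
          + ∑ i ∈ range W.L, (r i)⁻¹ * ⟪W.B i (v i), p (i + 1)⟫_ℝ := by
      rw [← sum_add_distrib]
      refine sum_congr rfl fun i hi => ?_
      rw [← input i (mem_range.1 hi), inner_sub_right, inner_smul_right,
        ContinuousLinearMap.adjoint_inner_right]
      ring
    have e₃ : ∑ i ∈ range (W.L + 1), ⟪y i, p i⟫_ℝ = ∑ i ∈ range (W.L + 1), ⟪g i, p i⟫_ℝ
        + ∑ i ∈ range W.L, r i * ⟪W.A i (y i) + W.B i (v i), p (i + 1)⟫_ℝ := by
      rw [sum_range_succ', sum_range_succ', initial, add_right_comm, ← sum_add_distrib]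
      congr 1
      refine sum_congr rfl fun i hi => ?_
      rw [← dynamics i (mem_range.1 hi), inner_sub_left, inner_smul_left]
      simp
    have e₄ : e ^ 2 = ∑ i ∈ range W.c, ⟪y i, f i⟫_ℝ + ∑ i ∈ range W.L, ⟪v i, h i⟫_ℝ
        - ∑ i ∈ range (W.L + 1), ⟪g i, p i⟫_ℝ
        + ∑ i ∈ range W.L, ((r i)⁻¹ - r i) * ⟪W.A i (y i) + W.B i (v i), p (i + 1)⟫_ℝ := by
      have t : ∑ i ∈ range W.L, ((r i)⁻¹ - r i) * ⟪W.A i (y i) + W.B i (v i), p (i + 1)⟫_ℝ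
          = ∑ i ∈ range W.L, (r i)⁻¹ * ⟪W.A i (y i), p (i + 1)⟫_ℝ
            + ∑ i ∈ range W.L, (r i)⁻¹ * ⟪W.B i (v i), p (i + 1)⟫_ℝ
            - ∑ i ∈ range W.L, r i * ⟪W.A i (y i) + W.B i (v i), p (i + 1)⟫_ℝ := by
        rw [← sum_add_distrib, ← sum_sub_distrib]
        exact sum_congr rfl fun i _ => by rw [inner_add_left]; ring
      rw [he2, e₁, e₂, e₃, t]
      ring
    have b₁ : ∑ i ∈ range W.c, ⟪y i, f i⟫_ℝ + ∑ i ∈ range W.L, ⟪v i, h i⟫_ℝ ≤ X * F := by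
      have := sum_mul_le_of_sum_sq_le (s := (range W.c).disjSum (range W.L))
        (q := Sum.elim (fun i => ‖y i‖) fun i => ‖v i‖)
        (r := Sum.elim (fun i => ‖f i‖) fun i => ‖h i‖) hX0 hF0
        (by simpa [sum_disjSum] using hX2.ge) (by simpa [sum_disjSum] using hF)
      simp only [sum_disjSum, Sum.elim_inl, Sum.elim_inr] at this
      exact (add_le_add (sum_le_sum fun i _ => real_inner_le_norm _ _)
        (sum_le_sum fun i _ => real_inner_le_norm _ _)).trans this
    have b₂ : -∑ i ∈ range (W.L + 1), ⟪g i, p i⟫_ℝ ≤ G * Λ := by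
      rw [← sum_neg_distrib]
      refine le_trans (sum_le_sum fun i _ => ?_)
        (sum_mul_le_of_sum_sq_le (q := fun i => ‖g i‖) (r := fun i => ‖p i‖) hG0 hΛ0 hG hΛ2.ge)
      exact (neg_le_abs _).trans (abs_real_inner_le_norm _ _)
    have b₃ : ∑ i ∈ range W.L, ((r i)⁻¹ - r i) * ⟪W.A i (y i) + W.B i (v i), p (i + 1)⟫_ℝ
        ≤ η₂ * (a + b) * X * Λ := by
      have c₁ := sum_mul_le_of_sum_sq_le (q := fun i => ‖y i‖) (r := fun i => ‖p (i + 1)‖)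
        hX0 hΛ0 hyL hp_shift
      have c₂ := sum_mul_le_of_sum_sq_le (q := fun i => ‖v i‖) (r := fun i => ‖p (i + 1)‖)
        hX0 hΛ0 hvL hp_shift
      calc _ ≤ ∑ i ∈ range W.L, (η₂ * a * (‖y i‖ * ‖p (i + 1)‖)
              + η₂ * b * (‖v i‖ * ‖p (i + 1)‖)) := by
            refine sum_le_sum fun i hi => ?_
            have hi := mem_range.1 hi
            have n : ‖W.A i (y i) + W.B i (v i)‖ ≤ a * ‖y i‖ + b * ‖v i‖ :=
              (norm_add_le _ _).trans (add_le_add ((W.A i).le_of_opNorm_le (hW.A_le i hi) _)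
                ((W.B i).le_of_opNorm_le (hW.B_le i hi) _))
            calc _ ≤ |(r i)⁻¹ - r i| * |⟪W.A i (y i) + W.B i (v i), p (i + 1)⟫_ℝ| := by
                  rw [← abs_mul]; exact le_abs_self _
              _ ≤ η₂ * ((a * ‖y i‖ + b * ‖v i‖) * ‖p (i + 1)‖) := by
                  refine mul_le_mul (hr₂ i hi) ((abs_real_inner_le_norm _ _).trans ?_)
                    (abs_nonneg _) hη₂
                  gcongr
              _ = _ := by ring
        _ ≤ η₂ * a * (X * Λ) + η₂ * b * (X * Λ) := by
            rw [sum_add_distrib, ← mul_sum, ← mul_sum]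
            have := hW.a_nonneg
            have := hW.b_nonneg
            gcongr
        _ = _ := by ring
    linarith [e₄]
  · have hnorm : ∀ i < W.c, ‖p i - ((W.A i)†) (p (i + 1))‖
        ≤ (‖f i‖ + ‖W.Q i (y i)‖) + η₁ * ‖((W.A i)†) (p (i + 1))‖ := by
      intro i hi
      have key : p i - ((W.A i)†) (p (i + 1))
          = (f i - W.Q i (y i)) + ((r i)⁻¹ - 1) • ((W.A i)†) (p (i + 1)) := by
        rw [← state i hi, sub_smul, one_smul]
        abel
      rw [key]
      refine (norm_add_le _ _).trans (add_le_add (norm_sub_le _ _) ?_)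
      rw [norm_smul, Real.norm_eq_abs]
      rcases lt_or_ge i W.L with hL | hL
      · gcongr
        exact hr₁ i hL
      · rw [p_zero (i + 1) (by omega)]
        simp
    have hnorm' : ∀ i < W.L, ‖((W.B i)†) (p (i + 1))‖
        ≤ (‖h i‖ + ‖W.R i (v i)‖) + η₁ * ‖((W.B i)†) (p (i + 1))‖ := by
      intro i hi
      have key : ((W.B i)†) (p (i + 1))
          = (W.R i (v i) - h i) - ((r i)⁻¹ - 1) • ((W.B i)†) (p (i + 1)) := by
        rw [← input i hi, sub_smul, one_smul]
        abel
      conv_lhs => rw [key]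
      refine (norm_sub_le _ _).trans (add_le_add ((norm_sub_le _ _).trans_eq (add_comm _ _)) ?_)
      rw [norm_smul, Real.norm_eq_abs]
      gcongr
      exact hr₁ i hi
    have s₁ : ∑ i ∈ range W.c, ‖W.Q i (y i)‖ ^ 2 + ∑ i ∈ range W.L, ‖W.R i (v i)‖ ^ 2
        ≤ (√ℓ * e) ^ 2 := by
      rw [mul_pow, Real.sq_sqrt hℓ, he2, mul_add, mul_sum, mul_sum]
      exact add_le_add (sum_le_sum fun i hi => hW.Q_upper i (mem_range.1 hi) _)
        (sum_le_sum fun i hi => hW.R_upper i (mem_range.1 hi) _)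
    have s₂ : ∑ i ∈ range W.c, (η₁ * ‖((W.A i)†) (p (i + 1))‖) ^ 2
        + ∑ i ∈ range W.L, (η₁ * ‖((W.B i)†) (p (i + 1))‖) ^ 2 ≤ (η₁ * (a + b) * Λ) ^ 2 := by
      have t₁ : ∑ i ∈ range W.c, (η₁ * ‖((W.A i)†) (p (i + 1))‖) ^ 2
          ≤ η₁ ^ 2 * a ^ 2 * Λ ^ 2 := by
        rw [← sum_range_eq_of_le hW.le_c fun i hi => by rw [p_zero (i + 1) (by omega)]; simp]
        refine le_trans (sum_le_sum fun i hi => ?_)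
          ((mul_sum _ _ _).symm.trans_le (mul_le_mul_of_nonneg_left hp_shift (by positivity)))
        rw [mul_pow, mul_assoc, ← mul_pow a]
        gcongr
        exact ((W.A i)†).le_of_opNorm_le (by
          rw [LinearIsometryEquiv.norm_map]; exact hW.A_le i (mem_range.1 hi)) _
      have t₂ : ∑ i ∈ range W.L, (η₁ * ‖((W.B i)†) (p (i + 1))‖) ^ 2
          ≤ η₁ ^ 2 * b ^ 2 * Λ ^ 2 := by
        refine le_trans (sum_le_sum fun i hi => ?_)
          ((mul_sum _ _ _).symm.trans_le (mul_le_mul_of_nonneg_left hp_shift (by positivity)))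
        rw [mul_pow, mul_assoc, ← mul_pow b]
        gcongr
        exact ((W.B i)†).le_of_opNorm_le (by
          rw [LinearIsometryEquiv.norm_map]; exact hW.B_le i (mem_range.1 hi)) _
      have : 0 ≤ η₁ ^ 2 * (a * b) * Λ ^ 2 := by
        have := mul_nonneg hW.a_nonneg hW.b_nonneg
        positivity
      nlinarith
    have t := sum_sq_add_le_of_sum_sq_le (s := (range W.c).disjSum (range W.L))
      (q := Sum.elim (fun i => ‖f i‖) fun i => ‖h i‖)
      (r := Sum.elim (fun i => ‖W.Q i (y i)‖) fun i => ‖W.R i (v i)‖) hF0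
      (mul_nonneg (Real.sqrt_nonneg ℓ) he0)
      (by simpa [sum_disjSum] using hF) (by simpa [sum_disjSum] using s₁)
    have t' := sum_sq_add_le_of_sum_sq_le (s := (range W.c).disjSum (range W.L))
      (r := Sum.elim (fun i => η₁ * ‖((W.A i)†) (p (i + 1))‖)
        fun i => η₁ * ‖((W.B i)†) (p (i + 1))‖)
      (add_nonneg hF0 (mul_nonneg (Real.sqrt_nonneg ℓ) he0))
      (mul_nonneg (mul_nonneg hη₁ hab) hΛ0) t (by simpa [sum_disjSum] using s₂)
    simp only [sum_disjSum, Sum.elim_inl, Sum.elim_inr] at t'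
    refine abs_le_of_sq_le_sq' (a := σ * Λ) ?_ (by positivity) |>.2
    rw [mul_pow, hΛ2]
    refine (hW.adjoint_lower p p_zero).trans (le_trans (add_le_add ?_ ?_) t')
    · refine sum_le_sum fun i hi => ?_
      gcongr
      exact hnorm i (mem_range.1 hi)
    · refine sum_le_sum fun i hi => ?_
      gcongr
      exact hnorm' i (mem_range.1 hi)
  · rw [he2, hX2, mul_add, mul_sum, mul_sum]
    exact add_le_add (sum_le_sum fun i hi => hW.Q_lower i (mem_range.1 hi) _)
      (sum_le_sum fun i hi => hW.R_lower i (mem_range.1 hi) _)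

end LQWindow

/-- The relations between the data bounds, a decay rate `ρ` and a gain `C` under which the solution
operator of the Karush-Kuhn-Tucker system decays exponentially. -/
structure DecayConstants (μ ℓ a b σ ρ C : ℝ) : Prop where
  μ_pos : 0 < μ
  μ_le : μ ≤ ℓ
  σ_pos : 0 < σ
  ρ_pos : 0 < ρ
  ρ_lt_one : ρ < 1
  rate₁ : (ρ⁻¹ - 1) * (a + b) ≤ σ / 5
  rate₂ : (ρ⁻¹ - ρ) * (a + b) * √ℓ ≤ 3 / 10 * (σ * √μ)
  gain_primal : 3 / μ ≤ C
  gain_mixed : 5 * (√ℓ / (√μ * σ)) ≤ C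
  gain_dual : 75 / 16 * (ℓ / σ ^ 2) ≤ C

lemma DecayConstants.C_pos {μ ℓ a b σ ρ C : ℝ} (hC : DecayConstants μ ℓ a b σ ρ C) : 0 < C :=
  lt_of_lt_of_le (div_pos three_pos hC.μ_pos) hC.gain_primal

lemma sum_range_geometric_le {ρ : ℝ} (h0 : 0 ≤ ρ) (h1 : ρ < 1) (M : ℕ) :
    ∑ i ∈ range M, ρ ^ i ≤ 1 / (1 - ρ) := by
  rw [one_div, ← tsum_geometric_of_lt_one h0 h1]
  exact (summable_geometric_of_lt_one h0 h1).sum_le_tsum _ fun i _ => pow_nonneg h0 i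

lemma sum_range_pow_dist_le {ρ : ℝ} (h0 : 0 ≤ ρ) (h1 : ρ < 1) (M j : ℕ) :
    ∑ i ∈ range M, ρ ^ Nat.dist i j ≤ 2 / (1 - ρ) := by
  calc ∑ i ∈ range M, ρ ^ Nat.dist i j ≤ ∑ i ∈ range (j + M), ρ ^ Nat.dist i j :=
        sum_le_sum_of_subset_of_nonneg (range_mono (by omega)) fun _ _ _ => pow_nonneg h0 _
    _ = ∑ i ∈ range j, ρ ^ Nat.dist i j + ∑ i ∈ range M, ρ ^ Nat.dist (j + i) j :=
        sum_range_add _ _ _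
    _ ≤ ∑ i ∈ range j, ρ ^ i + ∑ i ∈ range M, ρ ^ i := by
        rw [← sum_range_reflect (fun i => ρ ^ i) j]
        refine add_le_add (sum_le_sum fun i hi => ?_) (sum_le_sum fun i _ => ?_)
        · have := mem_range.1 hi
          exact pow_le_pow_of_le_one h0 h1.le (by rw [Nat.dist]; omega)
        · exact pow_le_pow_of_le_one h0 h1.le (by rw [Nat.dist]; omega)
    _ ≤ 1 / (1 - ρ) + 1 / (1 - ρ) :=
        add_le_add (sum_range_geometric_le h0 h1 _) (sum_range_geometric_le h0 h1 _)
    _ = 2 / (1 - ρ) := by ring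

lemma sum_sq_add_sum_sq_le_sq {ι κ : Type*} {s : Finset ι} {t : Finset κ} {q : ι → ℝ} {r : κ → ℝ}
    (hq : ∀ i ∈ s, 0 ≤ q i) (hr : ∀ i ∈ t, 0 ≤ r i) :
    ∑ i ∈ s, q i ^ 2 + ∑ i ∈ t, r i ^ 2 ≤ (∑ i ∈ s, q i + ∑ i ∈ t, r i) ^ 2 := by
  nlinarith [sum_sq_le_sq_sum_of_nonneg hq, sum_sq_le_sq_sum_of_nonneg hr, sum_nonneg hq,
    sum_nonneg hr, mul_nonneg (sum_nonneg hq) (sum_nonneg hr)]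

namespace LQWindow

variable {E U : Type*} [NormedAddCommGroup E] [InnerProductSpace ℝ E] [CompleteSpace E]
  [NormedAddCommGroup U] [InnerProductSpace ℝ U] [CompleteSpace U]

/-- Exponential decay of the solution operator of the Karush-Kuhn-Tucker system. -/
lemma IsKKT.decay {W : LQWindow E U} {μ ℓ a b σ ρ C : ℝ} (hW : W.Bounded μ ℓ a b σ)
    (hC : DecayConstants μ ℓ a b σ ρ C) {f : ℕ → E} {h : ℕ → U} {g : ℕ → E}
    {y : ℕ → E} {v : ℕ → U} {p : ℕ → E} (hK : W.IsKKT f h g y v p) (j : ℕ) {S : ℝ}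
    (hS : ∑ i ∈ range W.c, ρ ^ Nat.dist i j * ‖f i‖ + ∑ i ∈ range W.L, ρ ^ Nat.dist i j * ‖h i‖
      + ∑ i ∈ range (W.L + 1), ρ ^ Nat.dist i j * ‖g i‖ ≤ S) :
    ‖y j‖ ≤ C * S ∧ ‖v j‖ ≤ C * S ∧ ‖p j‖ ≤ C * S := by
  have hρ := hC.ρ_pos
  have hρ1 := hC.ρ_lt_one
  have hinv : 1 < ρ⁻¹ := (one_lt_inv₀ hρ).2 hρ1
  obtain ⟨ω, hω⟩ : ∃ ω : ℕ → ℝ, ω = fun i => ρ ^ Nat.dist i j := ⟨_, rfl⟩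
  have hω0 : ∀ i, 0 < ω i := fun i => by rw [hω]; exact pow_pos hρ _
  have hωj : ω j = 1 := by simp [hω]
  have hratio : ∀ i, ω (i + 1) / ω i = ρ ∨ ω (i + 1) / ω i = ρ⁻¹ := by
    intro i
    simp only [hω]
    rcases lt_or_ge i j with hij | hij
    · right
      have : Nat.dist i j = Nat.dist (i + 1) j + 1 := by simp only [Nat.dist]; omega
      rw [this, pow_succ]
      field_simp
    · left
      have : Nat.dist (i + 1) j = Nat.dist i j + 1 := by simp only [Nat.dist]; omega
      rw [this, pow_succ]
      field_simp
  have habs : |ρ⁻¹ - 1| = ρ⁻¹ - 1 ∧ |ρ - 1| ≤ ρ⁻¹ - 1 ∧ |ρ⁻¹ - ρ| = ρ⁻¹ - ρ := by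
    refine ⟨abs_of_nonneg (by linarith), ?_, abs_of_nonneg (by linarith)⟩
    rw [abs_of_neg (by linarith)]
    have : ρ * ρ⁻¹ = 1 := mul_inv_cancel₀ hρ.ne'
    nlinarith
  obtain ⟨F, hF⟩ : ∃ F, F = ∑ i ∈ range W.c, ω i * ‖f i‖ + ∑ i ∈ range W.L, ω i * ‖h i‖ := ⟨_, rfl⟩
  obtain ⟨G, hG⟩ : ∃ G, G = ∑ i ∈ range (W.L + 1), ω i * ‖g i‖ := ⟨_, rfl⟩
  have hF0 : 0 ≤ F := hF ▸ add_nonneg (sum_nonneg fun i _ => mul_nonneg (hω0 i).le (norm_nonneg _))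
    (sum_nonneg fun i _ => mul_nonneg (hω0 i).le (norm_nonneg _))
  have hG0 : 0 ≤ G := hG ▸ sum_nonneg fun i _ => mul_nonneg (hω0 i).le (norm_nonneg _)
  have hFG : F + G ≤ S := by
    rw [hF, hG, hω]
    exact hS
  have hnorm : ∀ (x : E) (i : ℕ), ‖ω i • x‖ = ω i * ‖x‖ := fun x i => by
    rw [norm_smul, Real.norm_eq_abs, abs_of_pos (hω0 i)]
  have hnorm' : ∀ (x : U) (i : ℕ), ‖ω i • x‖ = ω i * ‖x‖ := fun x i => by
    rw [norm_smul, Real.norm_eq_abs, abs_of_pos (hω0 i)]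
  have key := hW.twisted_bounds hC.μ_pos hC.μ_le hC.σ_pos (η₁ := ρ⁻¹ - 1) (η₂ := ρ⁻¹ - ρ)
    (by linarith) (by linarith) hC.rate₁ hC.rate₂ (r := fun i => ω (i + 1) / ω i)
    (f := fun i => ω i • f i) (h := fun i => ω i • h i) (g := fun i => ω i • g i)
    (y := fun i => ω i • y i) (v := fun i => ω i • v i) (p := fun i => ω i • p i) (F := F) (G := G)
    (fun i _ => by
      rcases hratio i with hr | hr <;> rw [hr]
      · exact habs.1.le
      · rw [inv_inv]; exact habs.2.1)
    (fun i _ => by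
      rcases hratio i with hr | hr <;> rw [hr]
      · exact habs.2.2.le
      · rw [inv_inv, abs_sub_comm]; exact habs.2.2.le)
    (fun i hi => by rw [hK.y_zero i hi, smul_zero])
    (fun i hi => by rw [hK.p_zero i hi, smul_zero])
    (fun i hi => by
      have := (hω0 (i + 1)).ne'
      rw [← hK.state i hi, map_smul, map_smul, smul_smul, smul_add, smul_sub]
      congr 4
      field_simp)
    (fun i hi => by
      have := (hω0 (i + 1)).ne'
      rw [← hK.input i hi, map_smul, map_smul, smul_smul, smul_sub]
      congr 2
      field_simp)
    (by rw [hK.initial])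
    (fun i hi => by
      have := (hω0 i).ne'
      rw [← hK.dynamics i hi, map_smul, map_smul, ← smul_add, smul_smul, smul_sub]
      congr 2
      field_simp)
    hF0 hG0
    (by
      simp only [hnorm, hnorm']
      rw [hF]
      exact sum_sq_add_sum_sq_le_sq (fun i _ => mul_nonneg (hω0 i).le (norm_nonneg _))
        (fun i _ => mul_nonneg (hω0 i).le (norm_nonneg _)))
    (by
      simp only [hnorm]
      rw [hG]
      exact sum_sq_le_sq_sum_of_nonneg fun i _ => mul_nonneg (hω0 i).le (norm_nonneg _))
  have hC0 := hC.C_pos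
  have hmix : 15 / 4 * (√ℓ / (√μ * σ)) ≤ C := by
    have : 0 ≤ √ℓ / (√μ * σ) :=
      div_nonneg (Real.sqrt_nonneg _) (mul_nonneg (Real.sqrt_nonneg _) hC.σ_pos.le)
    linarith [hC.gain_mixed]
  have hS0 : C * (F + G) ≤ C * S := by gcongr
  have hCS : 0 ≤ C * S := le_trans (by positivity) hS0
  have k₁ := key.1.trans (add_le_add (mul_le_mul_of_nonneg_right hC.gain_primal hF0)
    (mul_le_mul_of_nonneg_right hmix hG0))
  have k₂ := key.2.trans (add_le_add (mul_le_mul_of_nonneg_right hC.gain_mixed hF0)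
    (mul_le_mul_of_nonneg_right hC.gain_dual hG0))
  rw [← mul_add] at k₁ k₂
  refine ⟨?_, ?_, ?_⟩
  · rcases lt_or_ge j W.c with hj | hj
    · refine le_trans (Real.le_sqrt_of_sq_le ?_) (k₁.trans hS0)
      have : ‖y j‖ ^ 2 = ‖ω j • y j‖ ^ 2 := by rw [hωj, one_smul]
      rw [this]
      exact (single_le_sum (f := fun i => ‖ω i • y i‖ ^ 2) (fun _ _ => sq_nonneg _)
        (mem_range.2 hj)).trans (le_add_of_nonneg_right (sum_nonneg fun _ _ => sq_nonneg _))
    · rw [hK.y_zero j hj, norm_zero]; exact hCS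
  · rcases lt_or_ge j W.L with hj | hj
    · refine le_trans (Real.le_sqrt_of_sq_le ?_) (k₁.trans hS0)
      have : ‖v j‖ ^ 2 = ‖ω j • v j‖ ^ 2 := by rw [hωj, one_smul]
      rw [this]
      exact (single_le_sum (f := fun i => ‖ω i • v i‖ ^ 2) (fun _ _ => sq_nonneg _)
        (mem_range.2 hj)).trans (le_add_of_nonneg_left (sum_nonneg fun _ _ => sq_nonneg _))
    · rw [hK.v_zero j hj, norm_zero]; exact hCS
  · rcases lt_or_ge W.L j with hj | hj
    · rw [hK.p_zero j hj, norm_zero]; exact hCS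
    · refine le_trans (Real.le_sqrt_of_sq_le ?_) (k₂.trans hS0)
      have : ‖p j‖ ^ 2 = ‖ω j • p j‖ ^ 2 := by rw [hωj, one_smul]
      rw [this]
      exact single_le_sum (f := fun i => ‖ω i • p i‖ ^ 2) (fun _ _ => sq_nonneg _)
        (mem_range.2 (by omega))

/-- Extension of a finite sequence by zero. -/
def extendZero {V : Type*} [Zero V] {k : ℕ} (q : Fin k → V) : ℕ → V :=
  fun i => if h : i < k then q ⟨i, h⟩ else 0

lemma extendZero_of_le {V : Type*} [Zero V] {k : ℕ} (q : Fin k → V) {i : ℕ} (h : k ≤ i) :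
    extendZero q i = 0 := dif_neg (by omega)

lemma extendZero_of_lt {V : Type*} [Zero V] {k : ℕ} (q : Fin k → V) {i : ℕ} (h : i < k) :
    extendZero q i = q ⟨i, h⟩ := dif_pos h

lemma extendZero_add {V : Type*} [AddCommGroup V] {k : ℕ} (q q' : Fin k → V) (i : ℕ) :
    extendZero (q + q') i = extendZero q i + extendZero q' i := by
  unfold extendZero; split <;> simp

lemma extendZero_smul {V : Type*} [AddCommGroup V] [Module ℝ V] {k : ℕ} (s : ℝ) (q : Fin k → V)
    (i : ℕ) : extendZero (s • q) i = s • extendZero q i := by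
  unfold extendZero; split <;> simp

/-- The linear map of the Karush-Kuhn-Tucker system. -/
def kktMap (W : LQWindow E U) :
    ((Fin W.c → E) × (Fin W.L → U) × (Fin (W.L + 1) → E)) →ₗ[ℝ]
      ((Fin W.c → E) × (Fin W.L → U) × (Fin (W.L + 1) → E)) where
  toFun x :=
    (fun i => W.Q i (extendZero x.1 i)
        + (extendZero x.2.2 i - ((W.A i)†) (extendZero x.2.2 (i + 1))),
      fun i => W.R i (extendZero x.2.1 i) - ((W.B i)†) (extendZero x.2.2 (i + 1)),
      fun i => extendZero x.1 i - if (i : ℕ) = 0 then 0 else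
        W.A (i - 1) (extendZero x.1 (i - 1)) + W.B (i - 1) (extendZero x.2.1 (i - 1)))
  map_add' x x' := by
    ext i
    · simp only [Prod.fst_add, Prod.snd_add, extendZero_add, map_add, Pi.add_apply]
      abel
    · simp only [Prod.fst_add, Prod.snd_add, extendZero_add, map_add, Pi.add_apply]
      abel
    · simp only [Prod.fst_add, Prod.snd_add, extendZero_add, map_add, Pi.add_apply]
      split <;> abel
  map_smul' s x := by
    ext i
    · simp only [Prod.smul_fst, Prod.smul_snd, extendZero_smul, map_smul, Pi.smul_apply,
        RingHom.id_apply, smul_add, smul_sub]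
    · simp only [Prod.smul_fst, Prod.smul_snd, extendZero_smul, map_smul, Pi.smul_apply,
        RingHom.id_apply, smul_sub]
    · simp only [Prod.smul_fst, Prod.smul_snd, extendZero_smul, map_smul, Pi.smul_apply,
        RingHom.id_apply, smul_sub]
      split <;> simp

lemma isKKT_of_kktMap_eq {W : LQWindow E U} {f : ℕ → E} {h : ℕ → U} {g : ℕ → E}
    {x : (Fin W.c → E) × (Fin W.L → U) × (Fin (W.L + 1) → E)}
    (hx : W.kktMap x = (fun (i : Fin _) => f i, fun (i : Fin _) => h i, fun (i : Fin _) => g i)) :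
    W.IsKKT f h g (extendZero x.1) (extendZero x.2.1) (extendZero x.2.2) where
  y_zero i hi := extendZero_of_le _ hi
  v_zero i hi := extendZero_of_le _ hi
  p_zero i hi := extendZero_of_le _ hi
  state i hi := congrFun (congrArg Prod.fst hx) ⟨i, hi⟩
  input i hi := congrFun (congrArg (fun z => z.2.1) hx) ⟨i, hi⟩
  initial := by simpa [kktMap] using congrFun (congrArg (fun z => z.2.2) hx) ⟨0, by omega⟩
  dynamics i hi := (congrArg (extendZero x.1 (i + 1) - ·) (if_neg i.succ_ne_zero).symm).trans
    (congrFun (congrArg (fun z => z.2.2) hx) ⟨i + 1, by omega⟩)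

lemma exists_isKKT [FiniteDimensional ℝ E] [FiniteDimensional ℝ U] {W : LQWindow E U}
    {μ ℓ a b σ ρ C : ℝ} (hW : W.Bounded μ ℓ a b σ) (hC : DecayConstants μ ℓ a b σ ρ C)
    (f : ℕ → E) (h : ℕ → U) (g : ℕ → E) : ∃ y v p, W.IsKKT f h g y v p := by
  have hinj : Function.Injective W.kktMap := by
    rw [← LinearMap.ker_eq_bot, LinearMap.ker_eq_bot']
    intro x hx
    have hK := isKKT_of_kktMap_eq (f := 0) (h := 0) (g := 0) hx
    have hz := fun j => hK.decay hW hC j (S := 0) (by simp)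
    simp only [mul_zero, norm_le_zero_iff] at hz
    ext i
    · simpa [extendZero_of_lt x.1 i.2] using (hz i).1
    · simpa [extendZero_of_lt x.2.1 i.2] using (hz i).2.1
    · simpa [extendZero_of_lt x.2.2 i.2] using (hz i).2.2
  obtain ⟨x, hx⟩ := LinearMap.injective_iff_surjective.1 hinj
    (fun (i : Fin _) => f i, fun (i : Fin _) => h i, fun (i : Fin _) => g i)
  exact ⟨_, _, _, isKKT_of_kktMap_eq hx⟩

/-- The quadratic tracking cost of a window. -/
def objective (W : LQWindow E U) (xbar : ℕ → E) (y : ℕ → E) (v : ℕ → U) : ℝ :=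
  ∑ i ∈ range W.c, ⟪y i - xbar i, W.Q i (y i - xbar i)⟫_ℝ + ∑ i ∈ range W.L, ⟪v i, W.R i (v i)⟫_ℝ

/-- Solutions of the Karush-Kuhn-Tucker system minimize the tracking cost strongly. -/
lemma IsKKT.objective_add_le {W : LQWindow E U} {μ ℓ a b σ : ℝ} (hW : W.Bounded μ ℓ a b σ)
    (hQ : ∀ i < W.c, ∀ x y, ⟪x, W.Q i y⟫_ℝ = ⟪W.Q i x, y⟫_ℝ)
    (hR : ∀ i < W.L, ∀ x y, ⟪x, W.R i y⟫_ℝ = ⟪W.R i x, y⟫_ℝ)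
    {xbar g : ℕ → E} {y : ℕ → E} {v : ℕ → U} {p : ℕ → E}
    (hK : W.IsKKT (fun i => W.Q i (xbar i)) 0 g y v p) {y' : ℕ → E} {v' : ℕ → U}
    (y_zero : ∀ i, W.c ≤ i → y' i = 0) (initial : y' 0 = g 0)
    (dynamics : ∀ i < W.L, y' (i + 1) - (W.A i (y' i) + W.B i (v' i)) = g (i + 1)) :
    W.objective xbar y v + μ * (∑ i ∈ range W.c, ‖y' i - y i‖ ^ 2
      + ∑ i ∈ range W.L, ‖v' i - v i‖ ^ 2) ≤ W.objective xbar y' v' := by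
  have hz : ∑ i ∈ range W.c, ⟪y' i - y i, p i - ((W.A i)†) (p (i + 1))⟫_ℝ
      - ∑ i ∈ range W.L, ⟪v' i - v i, ((W.B i)†) (p (i + 1))⟫_ℝ = 0 := by
    have t₁ : ∑ i ∈ range W.c, ⟪y' i - y i, p i⟫_ℝ
        = ∑ i ∈ range (W.L + 1), ⟪y' i - y i, p i⟫_ℝ :=
      sum_range_eq_of_le hW.c_le fun i hi => by
        rw [y_zero i hi, hK.y_zero i hi, sub_zero, inner_zero_left]
    have t₂ : ∑ i ∈ range W.L, ⟪W.A i (y' i - y i), p (i + 1)⟫_ℝ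
        = ∑ i ∈ range W.c, ⟪W.A i (y' i - y i), p (i + 1)⟫_ℝ :=
      sum_range_eq_of_le hW.le_c fun i hi => by
        rw [hK.p_zero (i + 1) (by omega), inner_zero_right]
    simp only [inner_sub_right, ContinuousLinearMap.adjoint_inner_right]
    rw [sum_sub_distrib, t₁, ← t₂, sum_range_succ', initial, hK.initial, sub_self, inner_zero_left,
      add_zero, ← sum_sub_distrib, ← sum_sub_distrib]
    refine sum_eq_zero fun i hi => ?_
    have hi := mem_range.1 hi
    rw [← inner_sub_left, ← inner_sub_left]
    have : y' (i + 1) - y (i + 1) - W.A i (y' i - y i) - W.B i (v' i - v i) = 0 := by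
      rw [map_sub, map_sub, ← sub_eq_zero.2 ((dynamics i hi).trans (hK.dynamics i hi).symm)]
      abel
    rw [this, inner_zero_left]
  have hy : ∀ i ∈ range W.c, ⟪y i - xbar i, W.Q i (y i - xbar i)⟫_ℝ + μ * ‖y' i - y i‖ ^ 2
      - 2 * ⟪y' i - y i, p i - ((W.A i)†) (p (i + 1))⟫_ℝ
      ≤ ⟪y' i - xbar i, W.Q i (y' i - xbar i)⟫_ℝ := by
    intro i hi
    have hi := mem_range.1 hi
    have e : p i - ((W.A i)†) (p (i + 1)) = -W.Q i (y i - xbar i) := by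
      rw [map_sub, ← hK.state i hi]; abel
    have d : y' i - xbar i = (y' i - y i) + (y i - xbar i) := by abel
    rw [e, d, map_add, inner_add_left, inner_add_right, inner_add_right, inner_neg_right,
      hQ i hi (y i - xbar i) (y' i - y i), real_inner_comm (y' i - y i) (W.Q i (y i - xbar i))]
    linarith [hW.Q_lower i hi (y' i - y i)]
  have hv : ∀ i ∈ range W.L, ⟪v i, W.R i (v i)⟫_ℝ + μ * ‖v' i - v i‖ ^ 2
      + 2 * ⟪v' i - v i, ((W.B i)†) (p (i + 1))⟫_ℝ ≤ ⟪v' i, W.R i (v' i)⟫_ℝ := by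
    intro i hi
    have hi := mem_range.1 hi
    have e : ((W.B i)†) (p (i + 1)) = W.R i (v i) := by
      rw [← sub_eq_zero, ← neg_eq_zero, neg_sub]; exact hK.input i hi
    have d : v' i = (v' i - v i) + v i := by abel
    rw [e]
    conv_rhs => rw [d, map_add, inner_add_left, inner_add_right, inner_add_right,
      hR i hi (v i) (v' i - v i), real_inner_comm (v' i - v i) (W.R i (v i))]
    linarith [hW.R_lower i hi (v' i - v i)]
  have sy := sum_le_sum hy
  have sv := sum_le_sum hv
  rw [sum_sub_distrib, sum_add_distrib, ← mul_sum, ← mul_sum] at sy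
  rw [sum_add_distrib, sum_add_distrib, ← mul_sum, ← mul_sum] at sv
  unfold objective
  linarith

/-- The difference of two solutions solves the first system with a perturbed right-hand side. -/
lemma IsKKT.sub {W W' : LQWindow E U} (hL : W'.L = W.L) (hc : W'.c = W.c) {f f' : ℕ → E}
    {h h' : ℕ → U} {g g' : ℕ → E} {y y' : ℕ → E} {v v' : ℕ → U} {p p' : ℕ → E}
    (hK : W.IsKKT f h g y v p) (hK' : W'.IsKKT f' h' g' y' v' p') :
    W.IsKKT
      (fun i => f i - f' i - (W.Q i - W'.Q i) (y' i) + ((W.A i - W'.A i)†) (p' (i + 1)))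
      (fun i => h i - h' i - (W.R i - W'.R i) (v' i) + ((W.B i - W'.B i)†) (p' (i + 1)))
      (fun i => g i - g' i + if i = 0 then 0 else
        (W.A (i - 1) - W'.A (i - 1)) (y' (i - 1)) + (W.B (i - 1) - W'.B (i - 1)) (v' (i - 1)))
      (fun i => y i - y' i) (fun i => v i - v' i) (fun i => p i - p' i) where
  y_zero i hi := by rw [hK.y_zero i hi, hK'.y_zero i (hc ▸ hi), sub_zero]
  v_zero i hi := by rw [hK.v_zero i hi, hK'.v_zero i (hL ▸ hi), sub_zero]
  p_zero i hi := by rw [hK.p_zero i hi, hK'.p_zero i (hL ▸ hi), sub_zero]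
  state i hi := by
    rw [← hK.state i hi, ← hK'.state i (hc ▸ hi)]
    simp only [map_sub, sub_apply]
    abel
  input i hi := by
    rw [← hK.input i hi, ← hK'.input i (hL ▸ hi)]
    simp only [map_sub, sub_apply]
    abel
  initial := by simp [hK.initial, hK'.initial]
  dynamics i hi := by
    rw [← hK.dynamics i hi, ← hK'.dynamics i (hL ▸ hi)]
    simp only [map_sub, sub_apply, Nat.add_sub_cancel, if_neg i.succ_ne_zero]
    abel

/-- A bound on solutions of the Karush-Kuhn-Tucker system: the influence of the initial state decays,
and the remaining data, including an extra term of size `τ` in the last row, stay bounded. -/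
lemma IsKKT.norm_le {W : LQWindow E U} {μ ℓ a b σ ρ C : ℝ} (hW : W.Bounded μ ℓ a b σ)
    (hC : DecayConstants μ ℓ a b σ ρ C) {f : ℕ → E} {g : ℕ → E}
    {y : ℕ → E} {v : ℕ → U} {p : ℕ → E} (hK : W.IsKKT f 0 g y v p) {Df Dg τ : ℝ}
    (hDf : 0 ≤ Df) (hDg : 0 ≤ Dg) (hτ : 0 ≤ τ)
    (hf : ∀ i < W.c, ‖f i‖ ≤ Df)
    (hg : ∀ i < W.L, ‖g (i + 1)‖ ≤ Dg + if i + 1 = W.L then τ else 0) (j : ℕ) :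
    ‖y j‖ ≤ C * (ρ ^ j * ‖g 0‖ + 2 * (Df + Dg) / (1 - ρ) + τ) ∧
    ‖v j‖ ≤ C * (ρ ^ j * ‖g 0‖ + 2 * (Df + Dg) / (1 - ρ) + τ) ∧
    ‖p j‖ ≤ C * (ρ ^ j * ‖g 0‖ + 2 * (Df + Dg) / (1 - ρ) + τ) := by
  have hρ := hC.ρ_pos
  have hρ1 := hC.ρ_lt_one
  refine hK.decay hW hC j ?_
  have b₁ : ∑ i ∈ range W.c, ρ ^ Nat.dist i j * ‖f i‖ ≤ 2 / (1 - ρ) * Df := by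
    refine le_trans (sum_le_sum fun i hi => ?_) ((sum_mul _ _ _).symm.trans_le
      (mul_le_mul_of_nonneg_right (sum_range_pow_dist_le hρ.le hρ1 W.c j) hDf))
    gcongr
    exact hf i (mem_range.1 hi)
  have b₂ : ∑ i ∈ range W.L, ρ ^ Nat.dist (i + 1) j * ‖g (i + 1)‖ ≤ 2 / (1 - ρ) * Dg + τ := by
    have t₁ : ∑ i ∈ range W.L, ρ ^ Nat.dist (i + 1) j ≤ 2 / (1 - ρ) := by
      refine le_trans ?_ (sum_range_pow_dist_le hρ.le hρ1 (W.L + 1) j)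
      rw [sum_range_succ' (fun i => ρ ^ Nat.dist i j)]
      exact le_add_of_nonneg_right (pow_nonneg hρ.le _)
    have t₂ : ∑ i ∈ range W.L, (if i + 1 = W.L then τ else 0) ≤ τ := by
      cases hL : W.L with
      | zero => simpa using hτ
      | succ k => simp
    calc _ ≤ ∑ i ∈ range W.L, (ρ ^ Nat.dist (i + 1) j * Dg + if i + 1 = W.L then τ else 0) := by
          refine sum_le_sum fun i hi => ?_
          refine (mul_le_mul_of_nonneg_left (hg i (mem_range.1 hi)) (pow_nonneg hρ.le _)).trans ?_
          rw [mul_add]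
          refine add_le_add_right (mul_le_of_le_one_left ?_ (pow_le_one₀ hρ.le hρ1.le)) _
          split <;> simp [hτ]
      _ ≤ _ := by
          rw [sum_add_distrib, ← sum_mul]
          gcongr
  have b₃ : ρ ^ Nat.dist 0 j = ρ ^ j := by simp [Nat.dist]
  rw [sum_range_succ' (fun i => ρ ^ Nat.dist i j * ‖g i‖), b₃]
  simp only [Pi.zero_apply, norm_zero, mul_zero, sum_const_zero, add_zero]
  calc _ ≤ 2 / (1 - ρ) * Df + (2 / (1 - ρ) * Dg + τ + ρ ^ j * ‖g 0‖) := by gcongr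
    _ = _ := by ring

/-- The effect of a perturbation of the data of a window on the first input. -/
lemma IsKKT.norm_first_input_sub_le {W W' : LQWindow E U} {μ ℓ a b σ ρ C : ℝ}
    (hW : W.Bounded μ ℓ a b σ) (hC : DecayConstants μ ℓ a b σ ρ C)
    (hL : W'.L = W.L) (hc : W'.c = W.c) {f f' : ℕ → E} {g g' : ℕ → E} {y y' : ℕ → E} {v v' : ℕ → U}
    {p p' : ℕ → E} (hK : W.IsKKT f 0 g y v p) (hK' : W'.IsKKT f' 0 g' y' v' p')
    {δ X : ℕ → ℝ} (hδ : ∀ i, 0 ≤ δ i) (hX : ∀ i, 0 ≤ X i)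
    (hy : ∀ i < W.L, ‖y' i‖ ≤ X i) (hv : ∀ i < W.L, ‖v' i‖ ≤ X i)
    (hp : ∀ i < W.L, ‖p' (i + 1)‖ ≤ X i)
    {LA LB LQ LR Lf Lg τ₁ τ₂ : ℝ} (hLA : 0 ≤ LA) (hLB : 0 ≤ LB) (hLg : 0 ≤ Lg)
    (hτ₁ : 0 ≤ τ₁) (hτ₂ : 0 ≤ τ₂)
    (hA : ∀ i < W.L, ‖W.A i - W'.A i‖ ≤ LA * δ i) (hB : ∀ i < W.L, ‖W.B i - W'.B i‖ ≤ LB * δ i)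
    (hQ : ∀ i < W.L, ‖W.Q i - W'.Q i‖ ≤ LQ * δ i) (hR : ∀ i < W.L, ‖W.R i - W'.R i‖ ≤ LR * δ i)
    (hf : ∀ i < W.L, ‖f i - f' i‖ ≤ Lf * δ i) (hg₀ : g 0 = g' 0)
    (hg : ∀ i < W.L, ‖g (i + 1) - g' (i + 1)‖ ≤ Lg * δ i + if i + 1 = W.L then τ₁ else 0)
    (hlast : W.c = W.L + 1 → ‖f W.L - f' W.L - (W.Q W.L - W'.Q W.L) (y' W.L)‖ ≤ τ₂) :
    ‖v 0 - v' 0‖ ≤ C * (∑ i ∈ range W.L,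
      ρ ^ i * ((Lf + Lg + (LQ + LR + 2 * (LA + LB)) * X i) * δ i) + ρ ^ W.L * (τ₁ + τ₂)) := by
  have hρ := hC.ρ_pos
  have hρ1 := hC.ρ_lt_one
  refine ((hK.sub hL hc hK').decay hW hC 0 ?_).2.1
  have hdist : ∀ i, Nat.dist i 0 = i := fun i => by simp [Nat.dist]
  simp only [hdist]
  have bA : ∀ i < W.L, ‖((W.A i - W'.A i)†) (p' (i + 1))‖ ≤ LA * δ i * X i := fun i hi =>
    (((W.A i - W'.A i)†).le_of_opNorm_le ((LinearIsometryEquiv.norm_map _ _).trans_le (hA i hi))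
      _).trans (mul_le_mul_of_nonneg_left (hp i hi) (mul_nonneg hLA (hδ i)))
  have bB : ∀ i < W.L, ‖((W.B i - W'.B i)†) (p' (i + 1))‖ ≤ LB * δ i * X i := fun i hi =>
    (((W.B i - W'.B i)†).le_of_opNorm_le ((LinearIsometryEquiv.norm_map _ _).trans_le (hB i hi))
      _).trans (mul_le_mul_of_nonneg_left (hp i hi) (mul_nonneg hLB (hδ i)))
  have bA' : ∀ i < W.L, ‖(W.A i - W'.A i) (y' i)‖ ≤ LA * δ i * X i := fun i hi =>
    ((W.A i - W'.A i).le_of_opNorm_le (hA i hi) _).trans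
      (mul_le_mul_of_nonneg_left (hy i hi) (mul_nonneg hLA (hδ i)))
  have bB' : ∀ i < W.L, ‖(W.B i - W'.B i) (v' i)‖ ≤ LB * δ i * X i := fun i hi =>
    ((W.B i - W'.B i).le_of_opNorm_le (hB i hi) _).trans
      (mul_le_mul_of_nonneg_left (hv i hi) (mul_nonneg hLB (hδ i)))
  have bQ : ∀ i < W.L, ‖(W.Q i - W'.Q i) (y' i)‖ ≤ LQ * δ i * X i := fun i hi =>
    ((W.Q i - W'.Q i).le_of_opNorm_le (hQ i hi) _).trans
      (mul_le_mul_of_nonneg_left (hy i hi) ((norm_nonneg _).trans (hQ i hi)))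
  have bR : ∀ i < W.L, ‖(W.R i - W'.R i) (v' i)‖ ≤ LR * δ i * X i := fun i hi =>
    ((W.R i - W'.R i).le_of_opNorm_le (hR i hi) _).trans
      (mul_le_mul_of_nonneg_left (hv i hi) ((norm_nonneg _).trans (hR i hi)))
  have s₁ : ∑ i ∈ range W.c, ρ ^ i * ‖f i - f' i - (W.Q i - W'.Q i) (y' i)
        + ((W.A i - W'.A i)†) (p' (i + 1))‖
      ≤ ∑ i ∈ range W.L, ρ ^ i * (Lf * δ i + LQ * δ i * X i + LA * δ i * X i)
        + ρ ^ W.L * τ₂ := by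
    have t : ∑ i ∈ range W.L, ρ ^ i * ‖f i - f' i - (W.Q i - W'.Q i) (y' i)
        + ((W.A i - W'.A i)†) (p' (i + 1))‖
        ≤ ∑ i ∈ range W.L, ρ ^ i * (Lf * δ i + LQ * δ i * X i + LA * δ i * X i) := by
      refine sum_le_sum fun i hi => ?_
      have hi := mem_range.1 hi
      gcongr
      exact (norm_add_le _ _).trans (add_le_add ((norm_sub_le _ _).trans
        (add_le_add (hf i hi) (bQ i hi))) (bA i hi))
    rcases hW.c_le.lt_or_eq with hlt | heq
    · have : W.c = W.L := le_antisymm (Nat.lt_succ_iff.1 hlt) hW.le_c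
      rw [this]
      exact t.trans (le_add_of_nonneg_right (by positivity))
    · rw [heq, sum_range_succ]
      refine add_le_add t ?_
      rw [hK'.p_zero (W.L + 1) (by omega), map_zero, add_zero]
      gcongr
      exact hlast heq
  have s₂ : ∑ i ∈ range W.L, ρ ^ i * ‖(0 : ℕ → U) i - (0 : ℕ → U) i - (W.R i - W'.R i) (v' i)
        + ((W.B i - W'.B i)†) (p' (i + 1))‖
      ≤ ∑ i ∈ range W.L, ρ ^ i * (LR * δ i * X i + LB * δ i * X i) := by
    refine sum_le_sum fun i hi => ?_
    have hi := mem_range.1 hi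
    gcongr
    refine (norm_add_le _ _).trans (add_le_add ?_ (bB i hi))
    rw [Pi.zero_apply, sub_zero, zero_sub, norm_neg]
    exact bR i hi
  have s₃ : ∑ i ∈ range (W.L + 1), ρ ^ i * ‖g i - g' i + if i = 0 then 0 else
        (W.A (i - 1) - W'.A (i - 1)) (y' (i - 1)) + (W.B (i - 1) - W'.B (i - 1)) (v' (i - 1))‖
      ≤ ∑ i ∈ range W.L, ρ ^ i * (Lg * δ i + (LA * δ i * X i + LB * δ i * X i))
        + ρ ^ W.L * τ₁ := by
    rw [sum_range_succ', hg₀]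
    simp only [sub_self, if_true, add_zero, norm_zero, mul_zero, if_neg (Nat.succ_ne_zero _),
      Nat.add_sub_cancel]
    have t : ∑ i ∈ range W.L, (if i + 1 = W.L then ρ ^ W.L * τ₁ else 0) ≤ ρ ^ W.L * τ₁ := by
      cases hL : W.L with
      | zero => simpa using hτ₁
      | succ k => simp
    refine le_trans ?_ (add_le_add_right t _)
    rw [← sum_add_distrib]
    refine sum_le_sum fun i hi => ?_
    have hi := mem_range.1 hi
    have n := (norm_add_le _ _).trans (add_le_add (hg i hi)
      ((norm_add_le _ _).trans (add_le_add (bA' i hi) (bB' i hi))))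
    have hn : 0 ≤ Lg * δ i + (LA * δ i * X i + LB * δ i * X i) := by
      have := hδ i
      have := hX i
      positivity
    calc _ ≤ ρ ^ (i + 1) * (Lg * δ i + (if i + 1 = W.L then τ₁ else 0)
            + (LA * δ i * X i + LB * δ i * X i)) := by gcongr
      _ = ρ ^ (i + 1) * (Lg * δ i + (LA * δ i * X i + LB * δ i * X i))
            + ρ ^ (i + 1) * (if i + 1 = W.L then τ₁ else 0) := by ring
      _ ≤ _ := by
        refine add_le_add (mul_le_mul_of_nonneg_right
          (pow_le_pow_of_le_one hρ.le hρ1.le i.le_succ) hn) ?_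
        split
        · next hh => rw [hh]
        · simp
  refine (add_le_add (add_le_add s₁ s₂) s₃).trans_eq ?_
  have e : ∑ i ∈ range W.L, ρ ^ i * ((Lf + Lg + (LQ + LR + 2 * (LA + LB)) * X i) * δ i)
      = ∑ i ∈ range W.L, ρ ^ i * (Lf * δ i + LQ * δ i * X i + LA * δ i * X i)
        + ∑ i ∈ range W.L, ρ ^ i * (LR * δ i * X i + LB * δ i * X i)
        + ∑ i ∈ range W.L, ρ ^ i * (Lg * δ i + (LA * δ i * X i + LB * δ i * X i)) := by
    rw [← sum_add_distrib, ← sum_add_distrib]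
    exact sum_congr rfl fun i _ => by ring
  rw [e]
  ring

end LQWindow

lemma rate_bounds {lam x : ℝ} (h0 : 0 < lam) (hx0 : 0 < x) (hx : x ≤ 1 / 4)
    (h : lam ^ 2 * (1 + x) = 1 - x) : lam⁻¹ - 1 ≤ 6 / 5 * x ∧ lam⁻¹ - lam ≤ 21 / 10 * x := by
  have h1 : 1 ≤ lam * (1 + 6 / 5 * x) := by
    have hp : 0 ≤ lam * (1 + 6 / 5 * x) := by positivity
    refine (abs_le_of_sq_le_sq' (a := 1) ?_ hp).2
    have : 0 ≤ (lam * (1 + 6 / 5 * x)) ^ 2 * (1 + x) - 1 ^ 2 * (1 + x) := by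
      have e : (lam * (1 + 6 / 5 * x)) ^ 2 * (1 + x) = (1 - x) * (1 + 6 / 5 * x) ^ 2 := by
        rw [← h]; ring
      rw [e]
      nlinarith [mul_nonneg hx0.le (sub_nonneg.2 hx), mul_nonneg hx0.le (mul_nonneg hx0.le
        (sub_nonneg.2 hx))]
    exact le_of_mul_le_mul_right (by linarith) (by linarith : (0 : ℝ) < 1 + x)
  have h2 : 1 ≤ 21 / 20 * (lam * (1 + x)) := by
    have hp : 0 ≤ 21 / 20 * (lam * (1 + x)) := by positivity
    refine (abs_le_of_sq_le_sq' (a := 1) ?_ hp).2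
    have e : (21 / 20 * (lam * (1 + x))) ^ 2 = 441 / 400 * ((1 - x) * (1 + x)) := by
      rw [← h]; ring
    rw [e]
    nlinarith
  constructor
  · rw [sub_le_iff_le_add, inv_le_iff_one_le_mul₀ h0]
    linarith
  · rw [sub_le_iff_le_add, inv_le_iff_one_le_mul₀ h0]
    have h3 : (1 + x) * 1 ≤ (1 + x) * ((21 / 10 * x + lam) * lam) := by nlinarith
    exact le_of_mul_le_mul_left h3 (by linarith)

lemma condition_ratio_bounds {q σ sm sl w S c ℓ : ℝ} (hq : 0 < q) (hq1 : q ≤ 1) (hσ : 0 < σ)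
    (hσ1 : σ ≤ 1) (hm : 0 < sm) (hml : sm ≤ sl) (hc : 1 ≤ c) (hqℓ : q ≤ ℓ) (hwc : c ≤ w)
    (hwq : 1 + 2 / 3 * q ≤ w) (hS : 7 / 5 * (ℓ + c) ≤ S) :
    q * σ * sm / (sl * w) / S ≤ 1 / 4 ∧
    q * σ * sm / (sl * w) / S * (c - 1) ≤ σ * sm / (7 * sl) := by
  have hl : 0 < sl := hm.trans_le hml
  have hw : 0 < w := by linarith
  have hS0 : 0 < S := by linarith
  have hr : σ * sm / sl ≤ 1 := by
    rw [div_le_one hl]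
    nlinarith
  constructor
  · have h4 : 4 * q ≤ w * S := by
      have : (1 + 2 / 3 * q) * (7 / 5 * (q + 1)) ≤ w * S :=
        mul_le_mul hwq (by linarith) (by positivity) hw.le
      nlinarith [sq_nonneg (q - 9 / 10)]
    have e : q * σ * sm / (sl * w) / S = (q / (w * S)) * (σ * sm / sl) := by field_simp
    have h5 : q / (w * S) ≤ 1 / 4 := by
      rw [div_le_iff₀ (by positivity)]
      linarith
    rw [e]
    exact (mul_le_of_le_one_right (by positivity) hr).trans h5
  · have h7 : 7 * (q * (c - 1)) ≤ w * S := by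
      have e : q * (1 + c) ≤ ℓ + c := by nlinarith
      have : c * (7 / 5 * (q * (1 + c))) ≤ w * S :=
        mul_le_mul hwc (by linarith) (by positivity) hw.le
      nlinarith [mul_nonneg hq.le (sq_nonneg (c - 2))]
    have e : q * σ * sm / (sl * w) / S * (c - 1)
        = σ * sm / (7 * sl) * (7 * (q * (c - 1)) / (w * S)) := by field_simp
    rw [e]
    exact mul_le_of_le_one_right (by positivity) ((div_le_one (by positivity)).2 h7)

lemma gain_bounds {μ ℓ q σ sm sl w c : ℝ} (hq : 0 < q) (hq1 : q ≤ 1) (hqμ : q ≤ μ) (hμℓ : μ ≤ ℓ)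
    (hσ : 0 < σ) (hσ1 : σ ≤ 1) (hm : 0 < sm) (hml : sm ≤ sl) (em : sm ^ 2 = μ) (el : sl ^ 2 = ℓ)
    (hc : 1 ≤ c) (hww : 1 + 2 * μ ≤ w ^ 2) :
    3 / μ ≤ (ℓ + c) * (sl ^ 2 * w ^ 2 / (q ^ 2 * σ ^ 2 * sm ^ 2)) ∧
    5 * (sl / (sm * σ)) ≤ (ℓ + c) * (sl ^ 2 * w ^ 2 / (q ^ 2 * σ ^ 2 * sm ^ 2)) ∧
    75 / 16 * (ℓ / σ ^ 2) ≤ (ℓ + c) * (sl ^ 2 * w ^ 2 / (q ^ 2 * σ ^ 2 * sm ^ 2)) := by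
  have hl : 0 < sl := hm.trans_le hml
  have hμ : 0 < μ := by linarith
  have hℓ : 0 < ℓ := by linarith
  refine ⟨?_, ?_, ?_⟩
  · rw [el, em, div_le_iff₀ hμ]
    have : (ℓ + c) * (ℓ * w ^ 2 / (q ^ 2 * σ ^ 2 * μ)) * μ
        = (ℓ + c) * ℓ * w ^ 2 / (q ^ 2 * σ ^ 2) := by field_simp
    rw [this, le_div_iff₀ (by positivity)]
    calc 3 * (q ^ 2 * σ ^ 2) ≤ 3 * (q ^ 2 * 1 ^ 2) := by gcongr
      _ = 1 * q * (3 * q) := by ring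
      _ ≤ (ℓ + c) * ℓ * w ^ 2 := by gcongr <;> linarith
  · have h5 : 5 ≤ (ℓ + c) * w ^ 2 / q ^ 2 := by
      rw [le_div_iff₀ (by positivity)]
      calc 5 * q ^ 2 ≤ (q + 1) * (1 + 2 * q) := by nlinarith
        _ ≤ (ℓ + c) * w ^ 2 := mul_le_mul (by linarith) (by linarith) (by positivity) (by linarith)
    have hr : 1 ≤ sl / (sm * σ) := by
      rw [one_le_div (by positivity)]
      nlinarith
    have hrr : sl / (sm * σ) ≤ sl / (sm * σ) * (sl / (sm * σ)) := le_mul_of_one_le_left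
      (by positivity) hr
    calc 5 * (sl / (sm * σ)) ≤ (ℓ + c) * w ^ 2 / q ^ 2 * (sl / (sm * σ) * (sl / (sm * σ))) :=
          mul_le_mul h5 hrr (by positivity) (by positivity)
      _ = _ := by field_simp
  · have h5 : 75 / 16 * μ ≤ (ℓ + c) * w ^ 2 / q ^ 2 := by
      rw [le_div_iff₀ (by positivity)]
      calc 75 / 16 * μ * q ^ 2 ≤ 75 / 16 * μ * 1 ^ 2 := by gcongr
        _ ≤ (μ + 1) * (1 + 2 * μ) := by nlinarith [sq_nonneg (μ - 1 / 2)]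
        _ ≤ (ℓ + c) * w ^ 2 := mul_le_mul (by linarith) hww (by positivity) (by linarith)
    calc 75 / 16 * (ℓ / σ ^ 2) = 75 / 16 * μ * (ℓ / (σ ^ 2 * μ)) := by field_simp
      _ ≤ (ℓ + c) * w ^ 2 / q ^ 2 * (ℓ / (σ ^ 2 * μ)) :=
        mul_le_mul_of_nonneg_right h5 (by positivity)
      _ = _ := by rw [el, em]; field_simp

lemma decayConstants_of_eq {μ ℓ a b σ c w q s S lam C : ℝ} (hμ : 0 < μ) (hμℓ : μ ≤ ℓ)
    (hσ : 0 < σ) (hσ1 : σ ≤ 1) (ha : 0 ≤ a) (hb : 0 ≤ b) (hc : c = a + b + 1)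
    (hw : w = √(2 * μ + c ^ 2)) (hq : q = min μ 1) (hs : s = q * σ * √μ / (√ℓ * w))
    (hS : S = √2 * (ℓ + c)) (hlam : lam = √((S - s) / (S + s)))
    (hC : C = (ℓ + c) / (s ^ 2 * lam)) : DecayConstants μ ℓ a b σ lam C := by
  have hc1 : 1 ≤ c := by linarith
  have hℓ : 0 < ℓ := hμ.trans_le hμℓ
  have hw0 : 0 < w := hw ▸ Real.sqrt_pos.2 (by positivity)
  have hw2 : w ^ 2 = 2 * μ + c ^ 2 := by rw [hw, Real.sq_sqrt (by positivity)]
  have hq0 : 0 < q := hq ▸ lt_min hμ one_pos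
  have hqμ : q ≤ μ := hq ▸ min_le_left _ _
  have hq1 : q ≤ 1 := hq ▸ min_le_right _ _
  have hm : 0 < √μ := Real.sqrt_pos.2 hμ
  have hl : 0 < √ℓ := Real.sqrt_pos.2 hℓ
  have hml : √μ ≤ √ℓ := Real.sqrt_le_sqrt hμℓ
  have hs0 : 0 < s := by rw [hs]; positivity
  have hS0 : 0 < S := by rw [hS]; positivity
  have ht : 7 / 5 ≤ √2 := Real.le_sqrt_of_sq_le (by norm_num)
  have hwc : c ≤ w := (abs_le_of_sq_le_sq' (a := c) (by linarith) hw0.le).2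
  have hwq : 1 + 2 / 3 * q ≤ w :=
    (abs_le_of_sq_le_sq' (a := 1 + 2 / 3 * q) (by nlinarith) hw0.le).2
  have hww : 1 + 2 * μ ≤ w ^ 2 := by nlinarith
  obtain ⟨hx4, hxd⟩ := condition_ratio_bounds hq0 hq1 hσ hσ1 hm hml hc1 (hqμ.trans hμℓ) hwc hwq
    (hS ▸ mul_le_mul_of_nonneg_right ht (by linarith) : 7 / 5 * (ℓ + c) ≤ S)
  rw [← hs] at hx4 hxd
  obtain ⟨x, hx⟩ : ∃ x, x = s / S := ⟨_, rfl⟩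
  have hx0 : 0 < x := hx ▸ div_pos hs0 hS0
  rw [← hx] at hx4 hxd
  have harg : (S - s) / (S + s) = (1 - x) / (1 + x) := by
    rw [hx, div_eq_div_iff (by positivity) (by positivity)]
    field_simp
  have hlam0 : 0 < lam := by
    rw [hlam, harg]
    exact Real.sqrt_pos.2 (div_pos (by linarith) (by linarith))
  have hlam2 : lam ^ 2 * (1 + x) = 1 - x := by
    rw [hlam, harg, Real.sq_sqrt (div_nonneg (by linarith) (by linarith))]
    exact div_mul_cancel₀ _ (by linarith)
  have hlam1 : lam < 1 := by
    by_contra! hcon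
    nlinarith
  obtain ⟨r₁, r₂⟩ := rate_bounds hlam0 hx0 hx4 hlam2
  have hab : 0 ≤ a + b := add_nonneg ha hb
  have hcab : c - 1 = a + b := by linarith
  rw [hcab] at hxd
  have hCle : (ℓ + c) * (√ℓ ^ 2 * w ^ 2 / (q ^ 2 * σ ^ 2 * √μ ^ 2)) ≤ C := by
    have e : (ℓ + c) * (√ℓ ^ 2 * w ^ 2 / (q ^ 2 * σ ^ 2 * √μ ^ 2)) = (ℓ + c) / s ^ 2 := by
      rw [hs]
      field_simp
    rw [e, hC, ← div_div, le_div_iff₀ hlam0]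
    exact mul_le_of_le_one_right (by positivity) hlam1.le
  obtain ⟨g₁, g₂, g₃⟩ := gain_bounds hq0 hq1 hqμ hμℓ hσ hσ1 hm hml (Real.sq_sqrt hμ.le)
    (Real.sq_sqrt hℓ.le) hc1 hww
  refine ⟨hμ, hμℓ, hσ, hlam0, hlam1, ?_, ?_, g₁.trans hCle, g₂.trans hCle, g₃.trans hCle⟩
  · have h5 : σ * √μ / (7 * √ℓ) ≤ σ / 7 := by
      rw [div_le_div_iff₀ (by positivity) (by positivity)]
      linarith [mul_le_mul_of_nonneg_left hml hσ.le]
    linarith [mul_le_mul_of_nonneg_right r₁ hab]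
  · calc (lam⁻¹ - lam) * (a + b) * √ℓ ≤ 21 / 10 * x * (a + b) * √ℓ := by gcongr
      _ = 21 / 10 * (x * (a + b)) * √ℓ := by ring
      _ ≤ 21 / 10 * (σ * √μ / (7 * √ℓ)) * √ℓ := by gcongr
      _ = 3 / 10 * (σ * √μ) := by field_simp; ring

/-- The explicit constants satisfy the relations needed for exponential decay. -/
lemma Consts.decayConstants {K : Consts} (hμ : 0 < K.μ) (hμℓ : K.μ ≤ K.ℓ) (hσ : 0 < K.σ)
    (hσ1 : K.σ ≤ 1) (ha : 0 ≤ K.a) (hb : 0 ≤ K.b) :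
    DecayConstants K.μ K.ℓ K.a K.b K.σ K.lam2 (K.C2 / 4) := by
  have hℓ : 0 < K.ℓ := hμ.trans_le hμℓ
  refine decayConstants_of_eq hμ hμℓ hσ hσ1 ha hb rfl rfl rfl (s := K.sigmaHLow)
    (S := K.sigmaHHigh) ?_ ?_ rfl ?_
  · have : 2 * K.μ * K.ℓ + K.ℓ * (K.a + K.b + 1) ^ 2
        = K.ℓ * (2 * K.μ + (K.a + K.b + 1) ^ 2) := by ring
    rw [Consts.sigmaHLow, this, Real.sqrt_div hμ.le, Real.sqrt_mul hℓ.le]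
    ring
  · rw [Consts.sigmaHHigh]
    ring
  · rw [Consts.C2]
    ring

lemma three_le_mul_gain {μ ℓ a b σ ρ C : ℝ} (hC : DecayConstants μ ℓ a b σ ρ C) : 3 ≤ ℓ * C := by
  have h := (div_le_iff₀ hC.μ_pos).1 hC.gain_primal
  nlinarith [hC.μ_le, hC.C_pos]

lemma one_le_gain {μ ℓ a b σ ρ C : ℝ} (hC : DecayConstants μ ℓ a b σ ρ C) (hσ : σ ≤ 1) :
    1 ≤ C := by
  refine le_trans ?_ hC.gain_mixed
  have : 1 ≤ √ℓ / (√μ * σ) := by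
    have hm := Real.sqrt_pos.2 hC.μ_pos
    rw [one_le_div (mul_pos hm hC.σ_pos)]
    nlinarith [Real.sqrt_le_sqrt hC.μ_le]
  linarith

/-- Lower bounds for the constant `H₂`. -/
lemma Consts.le_H2 {K : Consts} {Rad Dxs : ℝ}
    (hC : DecayConstants K.μ K.ℓ K.a K.b K.σ K.lam2 (K.C2 / 4)) (hσ : K.σ ≤ 1)
    (hDw : 0 ≤ K.Dw) (hDx : 0 ≤ K.Dxbar) (hLA : 0 ≤ K.LA) (hLB : 0 ≤ K.LB) (hLQ : 0 ≤ K.LQ)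
    (hLP : 0 ≤ K.LP) (hLx : 0 ≤ K.Lxbar) (hLw : 0 ≤ K.Lw)
    (hR : 0 ≤ Rad) (hDxs : 0 ≤ Dxs) :
    1 ≤ K.C2 / 4 ∧ K.C2 / 4 ≤ K.H2 Rad Dxs ∧
    (K.C2 / 4) ^ 2 * (K.LQ + K.LR + 2 * (K.LA + K.LB)) ≤ K.H2 Rad Dxs ∧
    K.C2 / 4 * (K.ℓ * K.Lxbar + K.Dxbar * K.LQ + K.Lw)
      + (K.C2 / 4) ^ 2 * (K.LQ + K.LR + 2 * (K.LA + K.LB))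
        * (2 * (K.ℓ * K.Dxbar + K.Dw) / (1 - K.lam2) + (Rad + Dxs)) ≤ K.H2 Rad Dxs ∧
    (K.C2 / 4) ^ 2 * K.LP ≤ K.H2 Rad Dxs ∧
    K.C2 / 4 * (K.ℓ * K.Lxbar + K.Dxbar * K.LP) + (K.C2 / 4) ^ 2 * K.LP
        * (2 * (K.ℓ * K.Dxbar + K.Dw) / (1 - K.lam2) + (Rad + Dxs)) ≤ K.H2 Rad Dxs := by
  have hρ := hC.ρ_pos
  have hρ1 := hC.ρ_lt_one
  have hℓ : 0 < K.ℓ := hC.μ_pos.trans_le hC.μ_le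
  obtain ⟨C, hCdef⟩ : ∃ C, C = K.C2 / 4 := ⟨_, rfl⟩
  have hC1 : 1 ≤ C := hCdef ▸ one_le_gain hC hσ
  have hℓC : 3 ≤ K.ℓ * C := hCdef ▸ three_le_mul_gain hC
  obtain ⟨d, hd⟩ : ∃ d, d = 2 * (K.ℓ * K.Dxbar + K.Dw) / (1 - K.lam2) := ⟨_, rfl⟩
  have hd2 : 2 * (K.ℓ * K.Dxbar) ≤ d := by
    rw [hd, le_div_iff₀ (by linarith)]
    have := mul_nonneg hℓ.le hDx
    nlinarith [mul_nonneg this hρ.le]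
  have hd0 : 0 ≤ d := le_trans (by positivity) hd2
  obtain ⟨M, hM⟩ : ∃ M, M = max (K.LQ + K.LR) K.LP + 2 / K.lam2 * (K.LA + K.LB) := ⟨_, rfl⟩
  have hAB : 2 * (K.LA + K.LB) ≤ 2 / K.lam2 * (K.LA + K.LB) := by
    have : 2 ≤ 2 / K.lam2 := by rw [le_div_iff₀ hρ]; linarith
    gcongr
  have hM₁ : K.LQ + K.LR + 2 * (K.LA + K.LB) ≤ M := by
    rw [hM]; exact add_le_add (le_max_left _ _) hAB
  have hM₂ : K.LP ≤ M := by
    rw [hM]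
    exact (le_max_right _ _).trans (le_add_of_nonneg_right (le_trans (by positivity) hAB))
  have hM0 : 0 ≤ M := hLP.trans hM₂
  have hH : K.H2 Rad Dxs = 16 * C ^ 2 * M * (d + Rad + Dxs + 1)
      + 4 * C * (K.Lw + K.ℓ * K.Lxbar + K.Dxbar * K.LQ + 1) := by
    rw [Consts.H2, Consts.C2', hM, hd, hCdef]
    ring
  have hl := mul_nonneg hℓ.le hLx
  have hq := mul_nonneg hDx hLQ
  have hT : 0 ≤ C * (K.Lw + K.ℓ * K.Lxbar + K.Dxbar * K.LQ + 1) := by positivity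
  have hCM : 0 ≤ C ^ 2 * M := by positivity
  have hCM' : 0 ≤ C ^ 2 * M * (d + (Rad + Dxs)) := by positivity
  rw [← hCdef, ← hd, hH]
  have e : 16 * C ^ 2 * M * (d + Rad + Dxs + 1)
      = 16 * (C ^ 2 * M * (d + (Rad + Dxs))) + 16 * (C ^ 2 * M) := by ring
  have e' : 4 * C * (K.Lw + K.ℓ * K.Lxbar + K.Dxbar * K.LQ + 1)
      = 4 * (C * (K.Lw + K.ℓ * K.Lxbar + K.Dxbar * K.LQ + 1)) := by ring
  rw [e, e']
  have b₁ : C ^ 2 * (K.LQ + K.LR + 2 * (K.LA + K.LB)) ≤ C ^ 2 * M := by gcongr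
  have b₂ : C ^ 2 * K.LP ≤ C ^ 2 * M := by gcongr
  have b₃ : C ^ 2 * (K.LQ + K.LR + 2 * (K.LA + K.LB)) * (d + (Rad + Dxs))
      ≤ C ^ 2 * M * (d + (Rad + Dxs)) := by gcongr
  have b₄ : C ^ 2 * K.LP * (d + (Rad + Dxs)) ≤ C ^ 2 * M * (d + (Rad + Dxs)) := by gcongr
  have b₅ : C ≤ C * (K.Lw + K.ℓ * K.Lxbar + K.Dxbar * K.LQ + 1) :=
    le_mul_of_one_le_right (by linarith) (by linarith)
  have b₆ : C * (K.ℓ * K.Lxbar + K.Dxbar * K.LQ + K.Lw)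
      ≤ C * (K.Lw + K.ℓ * K.Lxbar + K.Dxbar * K.LQ + 1) := by
    exact mul_le_mul_of_nonneg_left (by linarith) (by linarith)
  have b₇ : C * (K.Dxbar * K.LP) ≤ C ^ 2 * M * (d + (Rad + Dxs)) := by
    calc C * (K.Dxbar * K.LP) ≤ C * (K.Dxbar * M) * 6 := by
          have : C * (K.Dxbar * K.LP) ≤ C * (K.Dxbar * M) := by gcongr
          have h0 : 0 ≤ C * (K.Dxbar * M) := by positivity
          linarith
      _ ≤ C * (K.Dxbar * M) * (2 * (K.ℓ * C)) := by
          gcongr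
          linarith
      _ = C ^ 2 * M * (2 * (K.ℓ * K.Dxbar)) := by ring
      _ ≤ C ^ 2 * M * (d + (Rad + Dxs)) := by
          gcongr
          linarith
  have b₈ : C * (K.ℓ * K.Lxbar) ≤ C * (K.Lw + K.ℓ * K.Lxbar + K.Dxbar * K.LQ + 1) := by
    exact mul_le_mul_of_nonneg_left (by linarith) (by linarith)
  exact ⟨hC1, by linarith, by linarith, by linarith, by linarith, by linarith⟩

open LQWindow

/-! ### Matrices as operators -/

/-- A matrix as a continuous linear map between Euclidean spaces. -/
def matCLM {d e : ℕ} : Matrix (Fin d) (Fin e) ℝ ≃ₗ[ℝ] (Vec e →L[ℝ] Vec d) :=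
  Matrix.toEuclideanLin.trans LinearMap.toContinuousLinearMap

lemma matCLM_apply {d e : ℕ} (M : Matrix (Fin d) (Fin e) ℝ) (x : Vec e) :
    matCLM M x = mulVec M x := rfl

lemma norm_matCLM {d e : ℕ} (M : Matrix (Fin d) (Fin e) ℝ) : ‖matCLM M‖ = ‖M‖ := rfl

lemma adjoint_matCLM {d e : ℕ} (M : Matrix (Fin d) (Fin e) ℝ) :
    (matCLM M)† = matCLM M.transpose := by
  have h := Matrix.toEuclideanLin_conjTranspose_eq_adjoint M
  rw [Matrix.conjTranspose_eq_transpose_of_trivial] at h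
  ext1 x
  change _ = (Matrix.toEuclideanLin M.transpose) x
  rw [h]
  rfl

lemma quad_eq_inner {d : ℕ} (M : Matrix (Fin d) (Fin d) ℝ) (x : Vec d) :
    quad M x = ⟪x, matCLM M x⟫_ℝ := by
  rw [matCLM_apply, quad, mulVec, EuclideanSpace.inner_eq_star_dotProduct, dotProduct_comm]
  simp

lemma mu_mul_norm_sq_le {d : ℕ} {M : Matrix (Fin d) (Fin d) ℝ} {μ : ℝ}
    (h : (M - μ • 1).PosSemidef) (x : Vec d) : μ * ‖x‖ ^ 2 ≤ ⟪x, matCLM M x⟫_ℝ := by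
  have h' := h.dotProduct_mulVec_nonneg x.ofLp
  have e : star x.ofLp ⬝ᵥ (M - μ • 1).mulVec x.ofLp = quad M x - μ * ‖x‖ ^ 2 := by
    rw [Matrix.sub_mulVec, dotProduct_sub, Matrix.smul_mulVec, Matrix.one_mulVec, dotProduct_smul,
      ← real_inner_self_eq_norm_sq, EuclideanSpace.inner_eq_star_dotProduct]
    simp [quad]
  rw [← quad_eq_inner]
  linarith

lemma inner_le_mul_norm_sq {d : ℕ} {M : Matrix (Fin d) (Fin d) ℝ} {ℓ : ℝ}
    (h : (ℓ • 1 - M).PosSemidef) (x : Vec d) : ⟪x, matCLM M x⟫_ℝ ≤ ℓ * ‖x‖ ^ 2 := by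
  have h' := h.dotProduct_mulVec_nonneg x.ofLp
  have e : star x.ofLp ⬝ᵥ (ℓ • 1 - M).mulVec x.ofLp = ℓ * ‖x‖ ^ 2 - quad M x := by
    rw [Matrix.sub_mulVec, dotProduct_sub, Matrix.smul_mulVec, Matrix.one_mulVec, dotProduct_smul,
      ← real_inner_self_eq_norm_sq, EuclideanSpace.inner_eq_star_dotProduct]
    simp [quad]
  rw [← quad_eq_inner]
  linarith

lemma inner_matCLM_comm {d : ℕ} {M : Matrix (Fin d) (Fin d) ℝ} {μ : ℝ}
    (h : (M - μ • 1).PosSemidef) (x y : Vec d) : ⟪x, matCLM M y⟫_ℝ = ⟪matCLM M x, y⟫_ℝ := by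
  have hM : M.transpose = M := by
    have h1 := h.isHermitian.eq
    rw [Matrix.conjTranspose_eq_transpose_of_trivial, Matrix.transpose_sub, Matrix.transpose_smul,
      Matrix.transpose_one] at h1
    exact sub_left_injective h1
  rw [← ContinuousLinearMap.adjoint_inner_left, adjoint_matCLM, hM]

lemma norm_sq_le_mul_inner {V : Type*} [NormedAddCommGroup V] [InnerProductSpace ℝ V]
    {S : V →L[ℝ] V} {ℓ : ℝ} (hℓ : 0 < ℓ) (hsymm : ∀ x y, ⟪x, S y⟫_ℝ = ⟪S x, y⟫_ℝ)
    (h0 : ∀ x, 0 ≤ ⟪x, S x⟫_ℝ) (hle : ∀ x, ⟪x, S x⟫_ℝ ≤ ℓ * ‖x‖ ^ 2) (x : V) :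
    ‖S x‖ ^ 2 ≤ ℓ * ⟪x, S x⟫_ℝ := by
  have h := h0 (x - ℓ⁻¹ • S x)
  have e : ⟪x - ℓ⁻¹ • S x, S (x - ℓ⁻¹ • S x)⟫_ℝ
      = ⟪x, S x⟫_ℝ - 2 * ℓ⁻¹ * ‖S x‖ ^ 2 + ℓ⁻¹ ^ 2 * ⟪S x, S (S x)⟫_ℝ := by
    rw [map_sub, map_smul, inner_sub_left, inner_sub_right, inner_sub_right, inner_smul_right,
      inner_smul_left, inner_smul_left, inner_smul_right, hsymm x (S x), real_inner_self_eq_norm_sq]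
    simp only [conj_trivial]
    ring
  rw [e] at h
  have h2 : ℓ⁻¹ ^ 2 * ⟪S x, S (S x)⟫_ℝ ≤ ℓ⁻¹ ^ 2 * (ℓ * ‖S x‖ ^ 2) := by
    gcongr
    exact hle _
  have h3 : ℓ⁻¹ ^ 2 * (ℓ * ‖S x‖ ^ 2) = ℓ⁻¹ * ‖S x‖ ^ 2 := by field_simp
  have h4 : ℓ⁻¹ * ‖S x‖ ^ 2 ≤ ⟪x, S x⟫_ℝ := by linarith
  rwa [inv_mul_le_iff₀ hℓ] at h4

lemma norm_matCLM_sq_le {d : ℕ} {M : Matrix (Fin d) (Fin d) ℝ} {μ ℓ : ℝ} (hμ : 0 < μ)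
    (hℓ : 0 < ℓ) (h : (M - μ • 1).PosSemidef) (h' : (ℓ • 1 - M).PosSemidef) (x : Vec d) :
    ‖matCLM M x‖ ^ 2 ≤ ℓ * ⟪x, matCLM M x⟫_ℝ :=
  norm_sq_le_mul_inner hℓ (inner_matCLM_comm h)
    (fun x => le_trans (by positivity) (mu_mul_norm_sq_le h x)) (inner_le_mul_norm_sq h') x

/-! ### The smallest singular value -/

lemma sq_mul_sum_sq_le_of_le_sigmaMin {ι κ : Type} [Fintype ι] [DecidableEq ι] [Fintype κ]
    {N : Matrix ι κ ℝ} {σ : ℝ} (hσ : 0 < σ) (h : σ ≤ sigmaMin N) (u : ι → ℝ) :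
    σ ^ 2 * ∑ i, u i ^ 2 ≤ ∑ j, (∑ i, N i j * u i) ^ 2 := by
  have hH := Matrix.isHermitian_mul_conjTranspose_self N
  have hev : ∀ i, σ ^ 2 ≤ hH.eigenvalues i := by
    intro i
    have h1 : σ ≤ √(hH.eigenvalues i) :=
      h.trans (ciInf_le (Set.finite_range _).bddBelow i)
    exact (Real.le_sqrt' hσ).1 h1
  obtain ⟨x, hx⟩ : ∃ x : EuclideanSpace ℝ ι, x = WithLp.toLp 2 u := ⟨_, rfl⟩
  obtain ⟨T, hT⟩ : ∃ T, T = Matrix.toEuclideanLin (N * N.conjTranspose) := ⟨_, rfl⟩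
  have hsymm : T.IsSymmetric := hT ▸ Matrix.isSymmetric_toEuclideanLin_iff.2 hH
  have hb : ∀ i, T (hH.eigenvectorBasis i) = hH.eigenvalues i • hH.eigenvectorBasis i := fun i => by
    rw [hT]
    ext1
    exact congrFun (hH.mulVec_eigenvectorBasis i) _
  have e₁ : ⟪x, T x⟫_ℝ = ∑ i, hH.eigenvalues i * ⟪hH.eigenvectorBasis i, x⟫_ℝ ^ 2 := by
    rw [← hH.eigenvectorBasis.sum_inner_mul_inner]
    refine sum_congr rfl fun i _ => ?_
    rw [← hsymm, hb, inner_smul_left, real_inner_comm x]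
    simp only [conj_trivial]
    ring
  have e₂ : ∑ i, u i ^ 2 = ∑ i, ⟪hH.eigenvectorBasis i, x⟫_ℝ ^ 2 := by
    have := hH.eigenvectorBasis.sum_sq_norm_inner_right x
    simp only [Real.norm_eq_abs, sq_abs] at this
    rw [this, EuclideanSpace.real_norm_sq_eq, hx]
  have e₃ : ⟪x, T x⟫_ℝ = ∑ j, (∑ i, N i j * u i) ^ 2 := by
    rw [EuclideanSpace.inner_eq_star_dotProduct, hT, hx, Matrix.ofLp_toLpLin,
      Matrix.toLin'_apply, dotProduct_comm, star_trivial, ← Matrix.mulVec_mulVec, Matrix.dotProduct_mulVec,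
      Matrix.conjTranspose_eq_transpose_of_trivial, Matrix.mulVec_transpose, dotProduct]
    refine sum_congr rfl fun j _ => ?_
    rw [Matrix.vecMul, dotProduct, sq]
    simp only [mul_comm (N _ j)]
  rw [← e₃, e₁, e₂, mul_sum]
  exact sum_le_sum fun i _ => mul_le_mul_of_nonneg_right (hev i) (sq_nonneg _)

/-! ### The window of an LTV problem -/

namespace LTV

variable {n m : ℕ} {p : ℕ → ℕ} {T : ℕ}

/-- The window of `L` steps from time `t` with `c` free states. -/
def window (D : LTV n m p T) (t L c : ℕ) (ξ : (t : ℕ) → Vec (p t)) : LQWindow (Vec n) (Vec m) where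
  L := L
  c := c
  A i := matCLM (D.A (t + i) (ξ (t + i)))
  B i := matCLM (D.B (t + i) (ξ (t + i)))
  Q i := matCLM (if i < L then D.Q (t + i) (ξ (t + i)) else D.P (ξ T))
  R i := matCLM (D.R (t + i) (ξ (t + i)))

/-- The tracked states in the window. -/
def windowTarget (D : LTV n m p T) (t L : ℕ) (ξ : (t : ℕ) → Vec (p t)) (i : ℕ) : Vec n :=
  if i < L then D.xbar (t + i) (ξ (t + i)) else D.xbar T (ξ T)

/-- The right-hand side of the dynamics in the window, with the state `ζ` subtracted from the last
one. -/
def windowRhs (D : LTV n m p T) (t L : ℕ) (z ζ : Vec n) (ξ : (t : ℕ) → Vec (p t)) : ℕ → Vec n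
  | 0 => z
  | i + 1 => D.w (t + i) (ξ (t + i)) - if i + 1 = L then ζ else 0

lemma sum_dynMatrix_inl (D : LTV n m p T) {t L c : ℕ} (hc : c ≤ L + 1) (ξ : (t : ℕ) → Vec (p t))
    {q : ℕ → Vec n} (hq : ∀ i, L < i → q i = 0) (j : Fin c) (β : Fin n) :
    ∑ r : Fin (L + 1) × Fin n, D.dynMatrix t L c ξ r (Sum.inl (j, β)) * q r.1 r.2
      = (q j - ((matCLM (D.A (t + j) (ξ (t + j))))†) (q (j + 1))) β := by
  have hj : (j : ℕ) < L + 1 := j.2.trans_le hc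
  obtain ⟨F, hF⟩ : ∃ F : ℕ → ℝ, F = fun r => (if (j : ℕ) = r then q j β else 0)
      + if (j : ℕ) + 1 = r then -∑ α, D.A (t + j) (ξ (t + j)) α β * q (j + 1) α else 0 := ⟨_, rfl⟩
  have h1 : ∀ r : Fin (L + 1), ∑ α : Fin n,
      D.dynMatrix t L c ξ (r, α) (Sum.inl (j, β)) * q r α
      = F r := by
    intro r
    rw [hF]
    simp only [dynMatrix, Matrix.of_apply]
    by_cases h : (j : ℕ) = r
    · have : (j : ℕ) + 1 ≠ r := by omega
      simp [h]
    · by_cases h' : (j : ℕ) + 1 = r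
      · simp [h']
        rw [← h']
        simp
      · simp [h, h']
  rw [Fintype.sum_prod_type, sum_congr rfl fun r _ => h1 r, Fin.sum_univ_eq_sum_range F, hF,
    sum_add_distrib, sum_ite_eq, sum_ite_eq, if_pos (mem_range.2 hj),
    adjoint_matCLM, matCLM_apply]
  have h2 : mulVec (D.A (t + j) (ξ (t + j))).transpose (q (j + 1)) β
      = ∑ α, D.A (t + j) (ξ (t + j)) α β * q (j + 1) α := rfl
  rw [PiLp.sub_apply, h2]
  split
  · ring
  · next h =>
    rw [hq (j + 1) (by simpa using h)]
    simp

lemma sum_dynMatrix_inr (D : LTV n m p T) {t L c : ℕ} (ξ : (t : ℕ) → Vec (p t))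
    (q : ℕ → Vec n) (j : Fin L) (β : Fin m) :
    ∑ r : Fin (L + 1) × Fin n, D.dynMatrix t L c ξ r (Sum.inr (j, β)) * q r.1 r.2
      = -(((matCLM (D.B (t + j) (ξ (t + j))))†) (q (j + 1))) β := by
  obtain ⟨F, hF⟩ : ∃ F : ℕ → ℝ, F = fun r =>
      if (j : ℕ) + 1 = r then -∑ α, D.B (t + j) (ξ (t + j)) α β * q (j + 1) α else 0 := ⟨_, rfl⟩
  have h1 : ∀ r : Fin (L + 1), ∑ α : Fin n,
      D.dynMatrix t L c ξ (r, α) (Sum.inr (j, β)) * q r α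
      = F r := by
    intro r
    rw [hF]
    simp only [dynMatrix, Matrix.of_apply]
    by_cases h' : (j : ℕ) + 1 = r
    · simp [h']
    · simp [h']
  rw [Fintype.sum_prod_type, sum_congr rfl fun r _ => h1 r, Fin.sum_univ_eq_sum_range F, hF, sum_ite_eq, if_pos (mem_range.2 (by omega)), adjoint_matCLM,
    matCLM_apply]
  rfl

lemma adjoint_lower_of_le_sigmaMin (D : LTV n m p T) {t L c : ℕ} (hc : c ≤ L + 1)
    (ξ : (t : ℕ) → Vec (p t)) {σ : ℝ} (hσ : 0 < σ) (h : σ ≤ sigmaMin (D.dynMatrix t L c ξ))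
    {q : ℕ → Vec n} (hq : ∀ i, L < i → q i = 0) :
    σ ^ 2 * ∑ i ∈ range (L + 1), ‖q i‖ ^ 2 ≤
      ∑ i ∈ range c, ‖q i - ((matCLM (D.A (t + i) (ξ (t + i))))†) (q (i + 1))‖ ^ 2
        + ∑ i ∈ range L, ‖((matCLM (D.B (t + i) (ξ (t + i))))†) (q (i + 1))‖ ^ 2 := by
  have key := sq_mul_sum_sq_le_of_le_sigmaMin hσ h fun r => q r.1 r.2
  rw [Fintype.sum_sum_type, Fintype.sum_prod_type, Fintype.sum_prod_type, Fintype.sum_prod_type]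
    at key
  simp only [D.sum_dynMatrix_inl hc ξ hq, D.sum_dynMatrix_inr ξ q, neg_sq,
    ← EuclideanSpace.real_norm_sq_eq] at key
  rwa [Fin.sum_univ_eq_sum_range (fun i => ‖q i‖ ^ 2),
    Fin.sum_univ_eq_sum_range
      (fun i => ‖q i - ((matCLM (D.A (t + i) (ξ (t + i))))†) (q (i + 1))‖ ^ 2),
    Fin.sum_univ_eq_sum_range
      (fun i => ‖((matCLM (D.B (t + i) (ξ (t + i))))†) (q (i + 1))‖ ^ 2)] at key

end LTV

namespace LTV

variable {n m : ℕ} {p : ℕ → ℕ} {T : ℕ}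

lemma Assumption.window_bounded {D : LTV n m p T} {k : ℕ} {K : Consts} (hD : D.Assumption k K)
    (hℓ : 0 < K.ℓ) (ha : 0 ≤ K.a) (hb : 0 ≤ K.b) {t L c : ℕ} (hL : 0 < L) (hc : L ≤ c)
    (hc' : c ≤ L + 1) (htL : t + L ≤ T) {ξ : (t : ℕ) → Vec (p t)}
    (hξ : ∀ τ, t ≤ τ → τ < t + L → ξ τ ∈ D.Xi τ) (hξT : c = L + 1 → ξ T ∈ D.Xi T)
    (hσ : K.σ ≤ sigmaMin (D.dynMatrix t L c ξ)) :
    (D.window t L c ξ).Bounded K.μ K.ℓ K.a K.b K.σ where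
  c_le := hc'
  le_c := hc
  c_pos := hL.trans_le hc
  a_nonneg := ha
  b_nonneg := hb
  Q_lower i hi y := by
    change i < c at hi
    simp only [window]
    split
    · exact mu_mul_norm_sq_le (hD.Q_lower _ (by omega) _ (hξ _ (by omega) (by omega))) y
    · exact mu_mul_norm_sq_le (hD.P_lower _ (hξT (by omega))) y
  Q_upper i hi y := by
    change i < c at hi
    simp only [window]
    split
    · exact norm_matCLM_sq_le hD.μ_pos hℓ
        (hD.Q_lower _ (by omega) _ (hξ _ (by omega) (by omega)))
        (hD.Q_upper _ (by omega) _ (hξ _ (by omega) (by omega))) y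
    · exact norm_matCLM_sq_le hD.μ_pos hℓ (hD.P_lower _ (hξT (by omega)))
        (hD.P_upper _ (hξT (by omega))) y
  R_lower i hi v := by
    change i < L at hi
    exact mu_mul_norm_sq_le (hD.R_lower _ (by omega) _ (hξ _ (by omega) (by omega))) v
  R_upper i hi v := by
    change i < L at hi
    exact norm_matCLM_sq_le hD.μ_pos hℓ
      (hD.R_lower _ (by omega) _ (hξ _ (by omega) (by omega)))
      (hD.R_upper _ (by omega) _ (hξ _ (by omega) (by omega))) v
  A_le i hi := by
    change i < L at hi
    exact hD.A_bound _ (by omega) _ (hξ _ (by omega) (by omega))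
  B_le i hi := by
    change i < L at hi
    exact hD.B_bound _ (by omega) _ (hξ _ (by omega) (by omega))
  adjoint_lower q hq := D.adjoint_lower_of_le_sigmaMin hc' ξ hD.σ_pos hσ hq

lemma Assumption.window_Q_symm {D : LTV n m p T} {k : ℕ} {K : Consts} (hD : D.Assumption k K)
    {t L c : ℕ} (hc' : c ≤ L + 1) (htL : t + L ≤ T) {ξ : (t : ℕ) → Vec (p t)}
    (hξ : ∀ τ, t ≤ τ → τ < t + L → ξ τ ∈ D.Xi τ) (hξT : c = L + 1 → ξ T ∈ D.Xi T)
    (i : ℕ) (hi : i < c) (x y : Vec n) :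
    ⟪x, (D.window t L c ξ).Q i y⟫_ℝ = ⟪(D.window t L c ξ).Q i x, y⟫_ℝ := by
  simp only [window]
  split
  · exact inner_matCLM_comm (hD.Q_lower _ (by omega) _ (hξ _ (by omega) (by omega))) x y
  · exact inner_matCLM_comm (hD.P_lower _ (hξT (by omega))) x y

lemma Assumption.window_R_symm {D : LTV n m p T} {k : ℕ} {K : Consts} (hD : D.Assumption k K)
    {t L c : ℕ} (htL : t + L ≤ T) {ξ : (t : ℕ) → Vec (p t)}
    (hξ : ∀ τ, t ≤ τ → τ < t + L → ξ τ ∈ D.Xi τ) (i : ℕ) (hi : i < L) (x y : Vec m) :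
    ⟪x, (D.window t L c ξ).R i y⟫_ℝ = ⟪(D.window t L c ξ).R i x, y⟫_ℝ :=
  inner_matCLM_comm (hD.R_lower _ (by omega) _ (hξ _ (by omega) (by omega))) x y

/-! ### Optimal trajectories and the Karush-Kuhn-Tucker system -/

/-- The states of a trajectory as a sequence, with `ζ` subtracted from the last one. -/
def shiftedState {L : ℕ} (ζ : Vec n) (q : Traj n m L) (i : ℕ) : Vec n :=
  extendZero q.1 i - if i = L then ζ else 0

lemma shiftedState_of_lt {L : ℕ} (ζ : Vec n) (q : Traj n m L) (i : Fin L) :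
    shiftedState ζ q i = q.1 i.castSucc := by
  rw [shiftedState, extendZero_of_lt q.1 (by omega), if_neg (by omega), sub_zero]
  rfl

lemma shiftedState_apply {L : ℕ} (ζ : Vec n) (q : Traj n m L) (i : Fin (L + 1)) :
    shiftedState ζ q i = q.1 i - if (i : ℕ) = L then ζ else 0 := by
  rw [shiftedState, extendZero_of_lt q.1 i.2]

lemma extendZero_fin {V : Type*} [Zero V] {k : ℕ} (q : Fin k → V) (i : Fin k) :
    extendZero q i = q i := extendZero_of_lt q i.2

lemma feasible_iff (D : LTV n m p T) {t L c : ℕ} (hL : 0 < L) (z ζ : Vec n)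
    (ξ : (t : ℕ) → Vec (p t)) (q : Traj n m L) :
    D.toProblem.Feasible t L z ξ q ↔ shiftedState ζ q 0 = z ∧ ∀ i < L,
      shiftedState ζ q (i + 1) - ((D.window t L c ξ).A i (shiftedState ζ q i)
        + (D.window t L c ξ).B i (extendZero q.2 i)) = D.windowRhs t L z ζ ξ (i + 1) := by
  have h0 : shiftedState ζ q 0 = q.1 0 := shiftedState_of_lt ζ q ⟨0, hL⟩
  have hstep : ∀ i : Fin L, (q.1 i.succ = D.toProblem.g (t + i) (q.1 i.castSucc) (q.2 i) (ξ (t + i))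
      ↔ shiftedState ζ q (i + 1) - ((D.window t L c ξ).A i (shiftedState ζ q i)
        + (D.window t L c ξ).B i (extendZero q.2 i)) = D.windowRhs t L z ζ ξ (i + 1)) := by
    intro i
    have h1 : shiftedState ζ q (i + 1) = q.1 i.succ - if (i : ℕ) + 1 = L then ζ else 0 :=
      shiftedState_apply ζ q i.succ
    rw [h1, shiftedState_of_lt, extendZero_fin]
    simp only [windowRhs, window, toProblem, matCLM_apply]
    rw [sub_right_comm, sub_left_inj, sub_eq_iff_eq_add, add_comm (D.w _ _)]
  rw [ControlProblem.Feasible, h0]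
  refine and_congr Iff.rfl ⟨fun h i hi => (hstep ⟨i, hi⟩).1 (h ⟨i, hi⟩).1, fun h i =>
    ⟨(hstep i).2 (h i i.2), fun j => j.elim0⟩⟩

lemma sum_stage_cost (D : LTV n m p T) {t L c : ℕ} (ζ : Vec n)
    (ξ : (t : ℕ) → Vec (p t)) (q : Traj n m L) :
    ∑ i : Fin L, D.toProblem.f (t + i) (q.1 i.castSucc) (q.2 i) (ξ (t + i)) =
      ∑ i ∈ range L, ⟪shiftedState ζ q i - D.windowTarget t L ξ i,
        (D.window t L c ξ).Q i (shiftedState ζ q i - D.windowTarget t L ξ i)⟫_ℝ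
      + ∑ i ∈ range L, ⟪extendZero q.2 i, (D.window t L c ξ).R i (extendZero q.2 i)⟫_ℝ := by
  rw [← sum_add_distrib, sum_range]
  refine sum_congr rfl fun i _ => ?_
  rw [shiftedState_of_lt, extendZero_fin]
  simp only [toProblem, windowTarget, window, if_pos i.2, quad_eq_inner]

/-- The window problem has a unique optimal trajectory, and it solves the Karush-Kuhn-Tucker
system. -/
def OptimalKKT (D : LTV n m p T) (t L c : ℕ) (z ζ : Vec n) (ξ : (t : ℕ) → Vec (p t))
    (G : Vec n → WithTop ℝ) : Prop :=
  ∃ (q : Traj n m L) (pp : ℕ → Vec n),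
    (D.window t L c ξ).IsKKT
      (fun i => (D.window t L c ξ).Q i (D.windowTarget t L ξ i)) 0 (D.windowRhs t L z ζ ξ)
      (shiftedState ζ q) (extendZero q.2) pp ∧
    D.toProblem.IsOptimal t L z ξ G q ∧ ∀ q', D.toProblem.IsOptimal t L z ξ G q' → q' = q

lemma OptimalKKT.existsUnique {D : LTV n m p T} {t L c : ℕ} {z ζ : Vec n}
    {ξ : (t : ℕ) → Vec (p t)} {G : Vec n → WithTop ℝ} (h : D.OptimalKKT t L c z ζ ξ G) :
    ∃! q, D.toProblem.IsOptimal t L z ξ G q := by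
  obtain ⟨q, _, _, h1, h2⟩ := h
  exact ⟨q, h1, h2⟩

lemma OptimalKKT.isKKT {D : LTV n m p T} {t L c : ℕ} {z ζ : Vec n}
    {ξ : (t : ℕ) → Vec (p t)} {G : Vec n → WithTop ℝ} (h : D.OptimalKKT t L c z ζ ξ G)
    {q : Traj n m L} (hq : D.toProblem.IsOptimal t L z ξ G q) :
    ∃ pp : ℕ → Vec n, (D.window t L c ξ).IsKKT
      (fun i => (D.window t L c ξ).Q i (D.windowTarget t L ξ i)) 0 (D.windowRhs t L z ζ ξ)
      (shiftedState ζ q) (extendZero q.2) pp := by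
  obtain ⟨q₀, pp, hK, _, huniq⟩ := h
  rw [huniq q hq]
  exact ⟨pp, hK⟩

lemma optimalKKT_of_cost {D : LTV n m p T} {t L c : ℕ} (hL : 0 < L) {ξ : (t : ℕ) → Vec (p t)}
    {μ ℓ a b σ ρ C : ℝ} (hW : (D.window t L c ξ).Bounded μ ℓ a b σ)
    (hC : DecayConstants μ ℓ a b σ ρ C)
    (hQ : ∀ i < c, ∀ x y, ⟪x, (D.window t L c ξ).Q i y⟫_ℝ = ⟪(D.window t L c ξ).Q i x, y⟫_ℝ)
    (hR : ∀ i < L, ∀ x y, ⟪x, (D.window t L c ξ).R i y⟫_ℝ = ⟪(D.window t L c ξ).R i x, y⟫_ℝ)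
    (z ζ : Vec n) (G : Vec n → WithTop ℝ)
    (hcost : ∀ q : Traj n m L, (∀ i, c ≤ i → shiftedState ζ q i = 0) →
      D.toProblem.cost t L ξ G q = ((D.window t L c ξ).objective (D.windowTarget t L ξ)
        (shiftedState ζ q) (extendZero q.2) : ℝ))
    (htop : ∀ q : Traj n m L, ¬ (∀ i, c ≤ i → shiftedState ζ q i = 0) →
      D.toProblem.cost t L ξ G q = ⊤) :
    D.OptimalKKT t L c z ζ ξ G := by
  obtain ⟨y, v, pp, hK⟩ := exists_isKKT hW hC
    (fun i => (D.window t L c ξ).Q i (D.windowTarget t L ξ i)) 0 (D.windowRhs t L z ζ ξ)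
  obtain ⟨q, hq⟩ : ∃ q : Traj n m L,
      q = (fun i : Fin (L + 1) => y i + if (i : ℕ) = L then ζ else 0, fun i : Fin L => v i) := ⟨_, rfl⟩
  have hy : shiftedState ζ q = y := by
    funext i
    rcases lt_or_ge i (L + 1) with hi | hi
    · exact (shiftedState_apply ζ q ⟨i, hi⟩).trans (by rw [hq]; simp)
    · rw [shiftedState, extendZero_of_le _ hi, if_neg (by omega), sub_zero,
        hK.y_zero i (hW.c_le.trans hi)]
  have hv : extendZero q.2 = v := by
    funext i
    rcases lt_or_ge i L with hi | hi
    · rw [extendZero_of_lt _ hi, hq]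
    · rw [extendZero_of_le _ hi, hK.v_zero i hi]
  rw [← hy, ← hv] at hK
  have hcq := hcost q hK.y_zero
  have hle : ∀ q' : Traj n m L, D.toProblem.Feasible t L z ξ q' →
      (∀ i, c ≤ i → shiftedState ζ q' i = 0) → _ := fun q' hf hz =>
    have hf' := (D.feasible_iff (c := c) hL z ζ ξ q').1 hf
    hK.objective_add_le hW hQ hR hz hf'.1 hf'.2
  have hopt : D.toProblem.IsOptimal t L z ξ G q := by
    refine ⟨(D.feasible_iff (c := c) hL z ζ ξ q).2 ⟨hK.initial, hK.dynamics⟩, ?_, fun q' hf => ?_⟩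
    · rw [hcq]
      exact WithTop.coe_lt_top _
    · by_cases hz : ∀ i, c ≤ i → shiftedState ζ q' i = 0
      · rw [hcq, hcost q' hz, WithTop.coe_le_coe]
        refine le_trans (le_add_of_nonneg_right ?_) (hle q' hf hz)
        have := hC.μ_pos
        positivity
      · rw [htop q' hz]
        exact le_top
  refine ⟨q, pp, hK, hopt, fun q' hq' => ?_⟩
  have hz : ∀ i, c ≤ i → shiftedState ζ q' i = 0 := by
    by_contra hz
    exact absurd hq'.2.1 (by rw [htop q' hz]; exact lt_irrefl _)
  have h1 := hle q' hq'.1 hz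
  have h2 := hq'.2.2 q hopt.1
  rw [hcq, hcost q' hz, WithTop.coe_le_coe] at h2
  have hsum : ∑ i ∈ range (D.window t L c ξ).c, ‖shiftedState ζ q' i - shiftedState ζ q i‖ ^ 2
      + ∑ i ∈ range (D.window t L c ξ).L, ‖extendZero q'.2 i - extendZero q.2 i‖ ^ 2 ≤ 0 := by
    by_contra! hpos
    have := mul_pos hC.μ_pos hpos
    linarith
  have n₁ := sum_nonneg fun i (_ : i ∈ range (D.window t L c ξ).c) =>
    sq_nonneg ‖shiftedState ζ q' i - shiftedState ζ q i‖
  have n₂ := sum_nonneg fun i (_ : i ∈ range (D.window t L c ξ).L) =>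
    sq_nonneg ‖extendZero q'.2 i - extendZero q.2 i‖
  have z₁ := (sum_eq_zero_iff_of_nonneg fun i _ => sq_nonneg _).1
    (le_antisymm (by linarith) n₁ : _ = (0 : ℝ))
  have z₂ := (sum_eq_zero_iff_of_nonneg fun i _ => sq_nonneg _).1
    (le_antisymm (by linarith) n₂ : _ = (0 : ℝ))
  refine Prod.ext (funext fun i => ?_) (funext fun i => ?_)
  · have : shiftedState ζ q' i = shiftedState ζ q i := by
      rcases lt_or_ge (i : ℕ) c with hi | hi
      · have := z₁ i (mem_range.2 hi)
        rwa [sq_eq_zero_iff, norm_eq_zero, sub_eq_zero] at this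
      · rw [hz i hi, hK.y_zero i hi]
    rw [shiftedState_apply, shiftedState_apply] at this
    exact sub_left_injective this
  · have := z₂ i (mem_range.2 i.2)
    rwa [sq_eq_zero_iff, norm_eq_zero, sub_eq_zero, extendZero_fin, extendZero_fin] at this

lemma optimalKKT_terminal {D : LTV n m p T} {t L : ℕ} (hL : 0 < L) {ξ : (t : ℕ) → Vec (p t)}
    {μ ℓ a b σ ρ C : ℝ} (hW : (D.window t L (L + 1) ξ).Bounded μ ℓ a b σ)
    (hC : DecayConstants μ ℓ a b σ ρ C)
    (hQ : ∀ i < L + 1, ∀ x y,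
      ⟪x, (D.window t L (L + 1) ξ).Q i y⟫_ℝ = ⟪(D.window t L (L + 1) ξ).Q i x, y⟫_ℝ)
    (hR : ∀ i < L, ∀ x y,
      ⟪x, (D.window t L (L + 1) ξ).R i y⟫_ℝ = ⟪(D.window t L (L + 1) ξ).R i x, y⟫_ℝ) (z : Vec n) :
    D.OptimalKKT t L (L + 1) z 0 ξ (fun y => D.toProblem.F y (ξ T)) := by
  refine optimalKKT_of_cost hL hW hC hQ hR z 0 _ (fun q _ => ?_) (fun q hq => absurd ?_ hq)
  · have hlast : D.toProblem.F (q.1 (Fin.last L)) (ξ T)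
        = ((⟪shiftedState 0 q L - D.windowTarget t L ξ L,
          (D.window t L (L + 1) ξ).Q L (shiftedState 0 q L - D.windowTarget t L ξ L)⟫_ℝ : ℝ) :
            WithTop ℝ) := by
      have : shiftedState 0 q L = q.1 (Fin.last L) :=
        (shiftedState_apply 0 q (Fin.last L)).trans (by simp)
      rw [this]
      simp only [toProblem, windowTarget, window, lt_irrefl, if_false, quad_eq_inner]
    rw [ControlProblem.cost, D.sum_stage_cost (c := L + 1) 0 ξ q, hlast, ← WithTop.coe_add,
      objective]
    have : (D.window t L (L + 1) ξ).c = L + 1 := rfl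
    rw [this, sum_range_succ]
    congr 1
    exact add_right_comm _ _ _
  · intro i hi
    rw [shiftedState, extendZero_of_le _ hi, if_neg (by omega), sub_zero]

lemma optimalKKT_indicator {D : LTV n m p T} {t L : ℕ} (hL : 0 < L) {ξ : (t : ℕ) → Vec (p t)}
    {μ ℓ a b σ ρ C : ℝ} (hW : (D.window t L L ξ).Bounded μ ℓ a b σ)
    (hC : DecayConstants μ ℓ a b σ ρ C)
    (hQ : ∀ i < L, ∀ x y, ⟪x, (D.window t L L ξ).Q i y⟫_ℝ = ⟪(D.window t L L ξ).Q i x, y⟫_ℝ)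
    (hR : ∀ i < L, ∀ x y, ⟪x, (D.window t L L ξ).R i y⟫_ℝ = ⟪(D.window t L L ξ).R i x, y⟫_ℝ)
    (z ζ : Vec n) :
    D.OptimalKKT t L L z ζ ξ (fun y => indicatorCost y ζ) := by
  have hz : ∀ q : Traj n m L,
      (∀ i, L ≤ i → shiftedState ζ q i = 0) ↔ q.1 (Fin.last L) = ζ := by
    intro q
    have h1 : shiftedState ζ q L = q.1 (Fin.last L) - ζ :=
      (shiftedState_apply ζ q (Fin.last L)).trans (by simp)
    constructor
    · intro h
      rw [← sub_eq_zero, ← h1]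
      exact h L le_rfl
    · intro h i hi
      rcases hi.eq_or_lt with rfl | hi
      · rw [h1, h, sub_self]
      · rw [shiftedState, extendZero_of_le _ hi, if_neg (by omega), sub_zero]
  refine optimalKKT_of_cost hL hW hC hQ hR z ζ _ (fun q hq => ?_) (fun q hq => ?_)
  · rw [ControlProblem.cost, D.sum_stage_cost (c := L) ζ ξ q, indicatorCost, if_pos ((hz q).1 hq),
      add_zero]
    rfl
  · rw [ControlProblem.cost, indicatorCost, if_neg (mt (hz q).2 hq), add_top]

end LTV

namespace LTV

variable {n m : ℕ} {p : ℕ → ℕ} {T : ℕ}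

lemma initialStateBound_of_optimalKKT {D : LTV n m p T} {t L c : ℕ} {z z' ζ : Vec n}
    {ξ : (t : ℕ) → Vec (p t)} {G : Vec n → WithTop ℝ} {μ ℓ a b σ ρ C H : ℝ}
    (hW : (D.window t L c ξ).Bounded μ ℓ a b σ) (hC : DecayConstants μ ℓ a b σ ρ C) (hCH : C ≤ H)
    (h : D.OptimalKKT t L c z ζ ξ G) (h' : D.OptimalKKT t L c z' ζ ξ G) :
    D.toProblem.InitialStateBound (fun i => H * ρ ^ i) t L z z' ξ G := by
  refine ⟨h.existsUnique, h'.existsUnique, fun q q' hq hq' => ?_⟩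
  obtain ⟨pp, hK⟩ := h.isKKT hq
  obtain ⟨pp', hK'⟩ := h'.isKKT hq'
  have key : ∀ j, ‖shiftedState ζ q j - shiftedState ζ q' j‖ ≤ H * ρ ^ j * ‖z - z'‖ ∧
      ‖extendZero q.2 j - extendZero q'.2 j‖ ≤ H * ρ ^ j * ‖z - z'‖ := by
    intro j
    have hd := (hK.sub rfl rfl hK').decay hW hC j (S := ρ ^ j * ‖z - z'‖) (by
      rw [sum_range_succ' (fun i => ρ ^ Nat.dist i j * _)]
      simp [windowRhs, Nat.dist])
    have hle : C * (ρ ^ j * ‖z - z'‖) ≤ H * ρ ^ j * ‖z - z'‖ := by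
      rw [← mul_assoc]
      have := hC.ρ_pos
      gcongr
    exact ⟨hd.1.trans hle, hd.2.1.trans hle⟩
  refine ⟨fun i => ?_, fun i => ?_⟩
  · have := (key i).1
    rwa [shiftedState_apply, shiftedState_apply, sub_sub_sub_cancel_right] at this
  · have := (key i).2
    rwa [extendZero_fin, extendZero_fin] at this

lemma norm_matCLM_apply_sub_le {d : ℕ} {M M' : Matrix (Fin d) (Fin d) ℝ} {x x' : Vec d}
    {ℓ Lx X LM δ : ℝ} (hM : ‖matCLM M‖ ≤ ℓ) (hx : ‖x - x'‖ ≤ Lx * δ) (hx' : ‖x'‖ ≤ X)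
    (hMM : ‖M - M'‖ ≤ LM * δ) : ‖matCLM M x - matCLM M' x'‖ ≤ (ℓ * Lx + X * LM) * δ := by
  have e : matCLM M x - matCLM M' x' = matCLM M (x - x') + matCLM (M - M') x' := by
    rw [map_sub, map_sub, sub_apply]
    abel
  have h1 := (matCLM M).le_of_opNorm_le_of_le hM hx
  have h2 := (matCLM (M - M')).le_of_opNorm_le_of_le hMM hx'
  rw [e]
  refine (norm_add_le _ _).trans ((add_le_add h1 h2).trans_eq ?_)
  ring

lemma norm_le_of_norm_sq_le_inner {V : Type*} [NormedAddCommGroup V] [InnerProductSpace ℝ V]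
    {S : V →L[ℝ] V} {ℓ : ℝ} (hℓ : 0 ≤ ℓ) (h : ∀ x, ‖S x‖ ^ 2 ≤ ℓ * ⟪x, S x⟫_ℝ) : ‖S‖ ≤ ℓ := by
  refine S.opNorm_le_bound hℓ fun x => ?_
  have h1 : ‖S x‖ * ‖S x‖ ≤ ℓ * ‖x‖ * ‖S x‖ := by
    have := mul_le_mul_of_nonneg_left (real_inner_le_norm x (S x)) hℓ
    nlinarith [h x]
  rcases (norm_nonneg (S x)).eq_or_lt with h0 | h0
  · rw [← h0]
    positivity
  · exact le_of_mul_le_mul_right h1 h0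

lemma Assumption.parameterBound {D : LTV n m p T} {k : ℕ} {K : Consts} (hD : D.Assumption k K)
    {t L c : ℕ} (hL : 0 < L) (hLc : L ≤ c) (hc' : c ≤ L + 1) (htL : t + L ≤ T)
    {ξ ξs : (t : ℕ) → Vec (p t)} {z ζ ζ' : Vec n} {G G' : Vec n → WithTop ℝ} {H τ δT : ℝ}
    (hξ : ∀ i, t ≤ i → i < t + L → ξ i ∈ D.Xi i) (hξs : ∀ i, t ≤ i → i < t + L → ξs i ∈ D.Xi i)
    (hC : DecayConstants K.μ K.ℓ K.a K.b K.σ K.lam2 (K.C2 / 4))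
    (hW : (D.window t L c ξ).Bounded K.μ K.ℓ K.a K.b K.σ)
    (hW' : (D.window t L c ξs).Bounded K.μ K.ℓ K.a K.b K.σ)
    (h : D.OptimalKKT t L c z ζ ξ G) (h' : D.OptimalKKT t L c z ζ' ξs G')
    (hDw : 0 ≤ K.Dw) (hDx : 0 ≤ K.Dxbar) (hζ' : ‖ζ'‖ ≤ τ)
    (hH₁ : (K.C2 / 4) ^ 2 * (K.LQ + K.LR + 2 * (K.LA + K.LB)) ≤ H)
    (hH₂ : K.C2 / 4 * (K.ℓ * K.Lxbar + K.Dxbar * K.LQ + K.Lw)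
      + (K.C2 / 4) ^ 2 * (K.LQ + K.LR + 2 * (K.LA + K.LB))
        * (2 * (K.ℓ * K.Dxbar + K.Dw) / (1 - K.lam2) + τ) ≤ H)
    (hcase : (c = L ∧ K.C2 / 4 * ‖ζ - ζ'‖ ≤ H * δT ∧ 0 ≤ H * δT) ∨
      (c = L + 1 ∧ ζ = ζ' ∧ ‖ξ T - ξs T‖ = δT ∧ ξ T ∈ D.Xi T ∧ ξs T ∈ D.Xi T ∧
        (K.C2 / 4) ^ 2 * K.LP ≤ H ∧
        K.C2 / 4 * (K.ℓ * K.Lxbar + K.Dxbar * K.LP) + (K.C2 / 4) ^ 2 * K.LP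
          * (2 * (K.ℓ * K.Dxbar + K.Dw) / (1 - K.lam2) + τ) ≤ H)) :
    D.toProblem.ParameterBound (fun i => H * K.lam2 ^ (2 * i)) (fun i => H * K.lam2 ^ i)
      t L hL z ξ ξs G G' δT := by
  refine ⟨h.existsUnique, h'.existsUnique, fun q q' hq hq' => ?_⟩
  obtain ⟨pp, hK⟩ := h.isKKT hq
  obtain ⟨pp', hK'⟩ := h'.isKKT hq'
  obtain ⟨C, hCdef⟩ : ∃ C, C = K.C2 / 4 := ⟨_, rfl⟩
  obtain ⟨ρ, hρdef⟩ : ∃ ρ, ρ = K.lam2 := ⟨_, rfl⟩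
  rw [← hCdef] at hC hH₁ hH₂ hcase
  rw [← hρdef] at hC hH₂ hcase ⊢
  have hρ := hC.ρ_pos
  have hρ1 := hC.ρ_lt_one
  have hC0 := hC.C_pos
  have hℓ : 0 < K.ℓ := hC.μ_pos.trans_le hC.μ_le
  have hτ : 0 ≤ τ := (norm_nonneg _).trans hζ'
  have hLA := hD.LA_nonneg
  have hLB := hD.LB_nonneg
  have hLQ := hD.LQ_nonneg
  have hLR := hD.LR_nonneg
  have hLP := hD.LP_nonneg
  have hLx := hD.Lxbar_nonneg
  have hLw := hD.Lw_nonneg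
  obtain ⟨d, hd⟩ : ∃ d, d = 2 * (K.ℓ * K.Dxbar + K.Dw) / (1 - ρ) + τ := ⟨_, rfl⟩
  rw [← hd] at hH₂ hcase
  have hd0 : 0 ≤ d := by
    have : 0 < 1 - ρ := by linarith
    rw [hd]
    positivity
  have hcT : c = L + 1 → ξ T ∈ D.Xi T ∧ ξs T ∈ D.Xi T := by
    rintro hc
    rcases hcase with ⟨h1, _⟩ | ⟨_, _, _, h1, h2, _⟩
    · omega
    · exact ⟨h1, h2⟩
  have hQn : ∀ i < c, ‖(D.window t L c ξ).Q i‖ ≤ K.ℓ := fun i hi =>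
    norm_le_of_norm_sq_le_inner hℓ.le (hW.Q_upper i hi)
  have hQn' : ∀ i < c, ‖(D.window t L c ξs).Q i‖ ≤ K.ℓ := fun i hi =>
    norm_le_of_norm_sq_le_inner hℓ.le (hW'.Q_upper i hi)
  have htarget : ∀ i < c, ‖D.windowTarget t L ξs i‖ ≤ K.Dxbar := by
    intro i hi
    rw [windowTarget]
    split
    · exact hD.xbar_bound _ (by omega) _ (hξs _ (by omega) (by omega))
    · exact hD.xbar_bound _ le_rfl _ (hcT (by omega)).2
  have hX := fun j => hK'.norm_le hW' hC (mul_nonneg hℓ.le hDx) hDw hτ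
    (fun i hi => ((D.window t L c ξs).Q i).le_of_opNorm_le_of_le (hQn' i hi) (htarget i hi))
    (fun i hi => by
      change i < L at hi
      refine (norm_sub_le _ _).trans (add_le_add
        (hD.w_bound _ (by omega) _ (hξs _ (by omega) (by omega))) ?_)
      change ‖if i + 1 = L then ζ' else 0‖ ≤ if i + 1 = L then τ else 0
      split
      · exact hζ'
      · rw [norm_zero]) j
  have hz : D.windowRhs t L z ζ' ξs 0 = z := rfl
  simp only [hz, add_assoc] at hX
  rw [← hd] at hX
  obtain ⟨X, hXdef⟩ : ∃ X : ℕ → ℝ, X = fun j => C * (ρ ^ j * ‖z‖ + d) := ⟨_, rfl⟩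
  have hX0 : ∀ j, 0 ≤ X j := fun j => by rw [hXdef]; positivity
  have hXy : ∀ j, ‖shiftedState ζ' q' j‖ ≤ X j := fun j => by rw [hXdef]; exact (hX j).1
  have hXv : ∀ j, ‖extendZero q'.2 j‖ ≤ X j := fun j => by rw [hXdef]; exact (hX j).2.1
  have hXp : ∀ j, ‖pp' (j + 1)‖ ≤ X j := fun j => by
    simp only [hXdef]
    refine (hX (j + 1)).2.2.trans ?_
    have : ρ ^ (j + 1) ≤ ρ ^ j := pow_le_pow_of_le_one hρ.le hρ1.le j.le_succ
    gcongr
  obtain ⟨δ, hδ⟩ : ∃ δ : ℕ → ℝ, δ = fun i => ‖ξ (t + i) - ξs (t + i)‖ := ⟨_, rfl⟩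
  have hδ0 : ∀ i, 0 ≤ δ i := fun i => by rw [hδ]; exact norm_nonneg _
  have hlast : ∃ τ₁ τ₂ : ℝ, ‖ζ - ζ'‖ ≤ τ₁ ∧ 0 ≤ τ₂ ∧
      (c = L + 1 → ‖(D.window t L c ξ).Q L (D.windowTarget t L ξ L)
        - (D.window t L c ξs).Q L (D.windowTarget t L ξs L)
        - ((D.window t L c ξ).Q L - (D.window t L c ξs).Q L) (shiftedState ζ' q' L)‖ ≤ τ₂) ∧
      C * (τ₁ + τ₂) ≤ H * δT * (ρ ^ L * ‖z‖ + 1) := by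
    rcases hcase with ⟨h1, h2, h3⟩ | ⟨h1, h2, h3, h4, h5, h6, h7⟩
    · refine ⟨‖ζ - ζ'‖, 0, le_rfl, le_rfl, fun hc => by omega, ?_⟩
      rw [add_zero]
      exact h2.trans (le_mul_of_one_le_right h3
        (le_add_of_nonneg_left (mul_nonneg (pow_nonneg hρ.le _) (norm_nonneg _))))
    · have hδT : 0 ≤ δT := h3 ▸ norm_nonneg _
      refine ⟨0, (K.ℓ * K.Lxbar + K.Dxbar * K.LP) * δT + K.LP * δT * X L, ?_, ?_, fun _ => ?_, ?_⟩
      · rw [h2, sub_self, norm_zero]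
      · have := hX0 L
        positivity
      · refine (norm_sub_le _ _).trans (add_le_add ?_ ?_)
        · have hq := hQn L (by omega)
          have ht := htarget L (by omega)
          simp only [window, windowTarget, lt_irrefl, if_false] at hq ht ⊢
          rw [← h3]
          exact norm_matCLM_apply_sub_le hq (hD.xbar_lip _ le_rfl _ h4 _ h5) ht
            (hD.P_lip _ h4 _ h5)
        · refine ContinuousLinearMap.le_of_opNorm_le_of_le _ ?_ (hXy L)
          simp only [window, lt_irrefl, if_false, ← map_sub, norm_matCLM]
          rw [← h3]
          exact hD.P_lip _ h4 _ h5
      · have e : C * (0 + ((K.ℓ * K.Lxbar + K.Dxbar * K.LP) * δT + K.LP * δT * X L))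
            = (C ^ 2 * K.LP) * (δT * (ρ ^ L * ‖z‖))
              + (C * (K.ℓ * K.Lxbar + K.Dxbar * K.LP) + C ^ 2 * K.LP * d) * δT := by
          rw [hXdef]; ring
        rw [e, mul_add (H * δT), mul_one]
        refine add_le_add ?_ (mul_le_mul_of_nonneg_right h7 hδT)
        rw [mul_assoc H]
        exact mul_le_mul_of_nonneg_right h6 (by positivity)
  obtain ⟨τ₁, τ₂, hτ₁, hτ₂, hlast, hτH⟩ := hlast
  have hmain := hK.norm_first_input_sub_le (W' := D.window t L c ξs) hW hC rfl rfl hK' hδ0 hX0 (fun i _ => hXy i)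
    (fun i _ => hXv i) (fun i _ => hXp i) hLA hLB hLw ((norm_nonneg _).trans hτ₁) hτ₂
    (LQ := K.LQ) (LR := K.LR) (Lf := K.ℓ * K.Lxbar + K.Dxbar * K.LQ)
    (fun i hi => by
      change i < L at hi
      simp only [window, ← map_sub, norm_matCLM, hδ]
      exact hD.A_lip _ (by omega) _ (hξ _ (by omega) (by omega)) _ (hξs _ (by omega) (by omega)))
    (fun i hi => by
      change i < L at hi
      simp only [window, ← map_sub, norm_matCLM, hδ]
      exact hD.B_lip _ (by omega) _ (hξ _ (by omega) (by omega)) _ (hξs _ (by omega) (by omega)))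
    (fun i hi => by
      change i < L at hi
      simp only [window, if_pos hi, ← map_sub, norm_matCLM, hδ]
      exact hD.Q_lip _ (by omega) _ (hξ _ (by omega) (by omega)) _ (hξs _ (by omega) (by omega)))
    (fun i hi => by
      change i < L at hi
      simp only [window, ← map_sub, norm_matCLM, hδ]
      exact hD.R_lip _ (by omega) _ (hξ _ (by omega) (by omega)) _ (hξs _ (by omega) (by omega)))
    (fun i hi => by
      change i < L at hi
      have hq := hQn i (by omega)
      have ht := htarget i (by omega)
      simp only [window, windowTarget, if_pos hi, hδ] at hq ht ⊢
      exact norm_matCLM_apply_sub_le hq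
        (hD.xbar_lip _ (by omega) _ (hξ _ (by omega) (by omega)) _ (hξs _ (by omega) (by omega))) ht
        (hD.Q_lip _ (by omega) _ (hξ _ (by omega) (by omega)) _ (hξs _ (by omega) (by omega))))
    rfl
    (fun i hi => by
      change i < L at hi
      change ‖D.w (t + i) (ξ (t + i)) - (if i + 1 = L then ζ else 0)
        - (D.w (t + i) (ξs (t + i)) - if i + 1 = L then ζ' else 0)‖
        ≤ K.Lw * δ i + if i + 1 = L then τ₁ else 0
      rw [sub_sub_sub_comm, hδ]
      refine (norm_sub_le _ _).trans (add_le_add (hD.w_lip _ (by omega) _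
        (hξ _ (by omega) (by omega)) _ (hξs _ (by omega) (by omega))) ?_)
      split
      · exact hτ₁
      · rw [sub_self, norm_zero])
    hlast
  change ‖extendZero q.2 0 - extendZero q'.2 0‖ ≤ C * (∑ i ∈ range L, _ + ρ ^ L * (τ₁ + τ₂))
    at hmain
  rw [extendZero_of_lt q.2 hL, extendZero_of_lt q'.2 hL, mul_add, mul_sum] at hmain
  refine hmain.trans ?_
  rw [add_mul, add_add_add_comm, sum_mul, ← sum_add_distrib]
  refine add_le_add (sum_le_sum fun i _ => ?_) ?_
  · have hi := hδ0 i
    have e : C * (ρ ^ i * ((K.ℓ * K.Lxbar + K.Dxbar * K.LQ + K.Lw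
          + (K.LQ + K.LR + 2 * (K.LA + K.LB)) * X i) * δ i))
        = C ^ 2 * (K.LQ + K.LR + 2 * (K.LA + K.LB)) * (ρ ^ (2 * i) * δ i * ‖z‖)
          + (C * (K.ℓ * K.Lxbar + K.Dxbar * K.LQ + K.Lw)
            + C ^ 2 * (K.LQ + K.LR + 2 * (K.LA + K.LB)) * d) * (ρ ^ i * δ i) := by
      rw [hXdef]; ring
    have e' : H * ρ ^ (2 * i) * ‖ξ (t + i) - ξs (t + i)‖ * ‖z‖
        + H * ρ ^ i * ‖ξ (t + i) - ξs (t + i)‖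
        = H * (ρ ^ (2 * i) * δ i * ‖z‖) + H * (ρ ^ i * δ i) := by
      rw [hδ]; ring
    rw [e, e']
    exact add_le_add (mul_le_mul_of_nonneg_right hH₁ (by positivity))
      (mul_le_mul_of_nonneg_right hH₂ (by positivity))
  · calc C * (ρ ^ L * (τ₁ + τ₂)) = ρ ^ L * (C * (τ₁ + τ₂)) := by ring
      _ ≤ ρ ^ L * (H * δT * (ρ ^ L * ‖z‖ + 1)) := by gcongr
      _ = _ := by ring

/-- Consequences of the assumption for the constants. -/
lemma Assumption.consts {D : LTV n m p T} {k : ℕ} {K : Consts} (hD : D.Assumption k K)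
    (hn : 0 < n) (hT : 0 < T) {ξs : (t : ℕ) → Vec (p t)} (hξs : ∀ t ≤ T, ξs t ∈ D.Xi t) :
    K.μ ≤ K.ℓ ∧ K.σ ≤ 1 ∧ 0 ≤ K.a ∧ 0 ≤ K.b ∧ 0 ≤ K.Dw ∧ 0 ≤ K.Dxbar := by
  have h0 := hξs 0 hT.le
  obtain ⟨x, hx⟩ : ∃ x : Vec n, ‖x‖ = 1 := ⟨EuclideanSpace.single ⟨0, hn⟩ 1, by simp⟩
  refine ⟨?_, ?_, (norm_nonneg _).trans (hD.A_bound 0 hT _ h0),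
    (norm_nonneg _).trans (hD.B_bound 0 hT _ h0), (norm_nonneg _).trans (hD.w_bound 0 hT _ h0),
    (norm_nonneg _).trans (hD.xbar_bound 0 hT.le _ h0)⟩
  · have := (mu_mul_norm_sq_le (hD.Q_lower 0 hT _ h0) x).trans
      (inner_le_mul_norm_sq (hD.Q_upper 0 hT _ h0) x)
    simpa [hx] using this
  · have h := D.adjoint_lower_of_le_sigmaMin (t := 0) le_rfl ξs hD.σ_pos
      (hD.N_sigma 0 T (zero_add T) hT ξs fun τ _ hτ => hξs τ hτ.le)
      (q := fun i => if i = 0 then x else 0) (fun i hi => if_neg (by omega))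
    rw [sum_range_succ', sum_range_succ'] at h
    simp [hx] at h
    exact (le_abs_self _).trans h

end LTV

end PredictiveControl

end

open PredictiveControl in
theorem theoremG1 {n m : ℕ} (hn : 0 < n) {p : ℕ → ℕ} {T : ℕ} (hT : 0 < T)
    (D : LTV n m p T) (k : ℕ) (hk : 0 < k) (K : Consts) (hD : D.Assumption k K)
    (ξs : (t : ℕ) → Vec (p t)) (hξs : ∀ t ≤ T, ξs t ∈ D.Xi t) (x0 : Vec n) :
    (∃! q : Traj n m T,
      D.toProblem.IsOptimal 0 T x0 ξs (fun y => D.toProblem.F y (ξs T)) q) ∧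
    0 < K.lam2 ∧ K.lam2 < 1 ∧
    ∀ (xs : ℕ → Vec n) (us : ℕ → Vec m),
      D.toProblem.IsOptimal 0 T x0 ξs (fun y => D.toProblem.F y (ξs T))
        (fun i => xs i, fun i => us i) →
      ∀ Dxs : ℝ, (∀ t ≤ T, ‖xs t‖ ≤ Dxs) →
      ∀ R : ℝ, 0 < R →
        1 ≤ K.H2 R Dxs ∧
        D.toProblem.PerturbationProperty k hk ξs xs R
          (fun t => K.H2 R Dxs * K.lam2 ^ (2 * t))
          (fun t => K.H2 R Dxs * K.lam2 ^ t)
          (fun t => K.H2 R Dxs * K.lam2 ^ t) := by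
  obtain ⟨hμℓ, hσ1, ha, hb, hDw, hDx⟩ := hD.consts hn hT hξs
  have hC := Consts.decayConstants hD.μ_pos hμℓ hD.σ_pos hσ1 ha hb
  have hℓ : 0 < K.ℓ := hD.μ_pos.trans_le hμℓ
  have hWt : ∀ (t L : ℕ), t + L = T → 0 < L → ∀ ξ : (t : ℕ) → Vec (p t),
      (∀ τ, t ≤ τ → τ ≤ T → ξ τ ∈ D.Xi τ) →
      (D.window t L (L + 1) ξ).Bounded K.μ K.ℓ K.a K.b K.σ := fun t L htL hL ξ hξ =>
    hD.window_bounded hℓ ha hb hL (by omega) le_rfl htL.le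
      (fun τ h1 h2 => hξ τ h1 (by omega)) (fun _ => hξ T (by omega) le_rfl)
      (hD.N_sigma t L htL hL ξ fun τ h1 h2 => hξ τ h1 h2.le)
  have hWi : ∀ t, t + k < T → ∀ ξ : (t : ℕ) → Vec (p t),
      (∀ τ, t ≤ τ → τ < t + k → ξ τ ∈ D.Xi τ) →
      (D.window t k k ξ).Bounded K.μ K.ℓ K.a K.b K.σ := fun t htk ξ hξ =>
    hD.window_bounded hℓ ha hb hk le_rfl (by omega) htk.le hξ (fun h => by omega)
      (hD.NHat_sigma t htk ξ hξ)
  have hOt : ∀ (t L : ℕ), t + L = T → 0 < L → ∀ ξ : (t : ℕ) → Vec (p t),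
      (∀ τ, t ≤ τ → τ ≤ T → ξ τ ∈ D.Xi τ) → ∀ z,
      D.OptimalKKT t L (L + 1) z 0 ξ (fun y => D.toProblem.F y (ξ T)) := fun t L htL hL ξ hξ z =>
    LTV.optimalKKT_terminal hL (hWt t L htL hL ξ hξ) hC
      (hD.window_Q_symm le_rfl htL.le (fun τ h1 h2 => hξ τ h1 (by omega))
        (fun _ => hξ T (by omega) le_rfl))
      (hD.window_R_symm htL.le (fun τ h1 h2 => hξ τ h1 (by omega))) z
  have hOi : ∀ t, t + k < T → ∀ ξ : (t : ℕ) → Vec (p t),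
      (∀ τ, t ≤ τ → τ < t + k → ξ τ ∈ D.Xi τ) → ∀ z ζ,
      D.OptimalKKT t k k z ζ ξ (fun y => indicatorCost y ζ) := fun t htk ξ hξ z ζ =>
    LTV.optimalKKT_indicator hk (hWi t htk ξ hξ) hC
      (hD.window_Q_symm (by omega) htk.le hξ (fun h => by omega))
      (hD.window_R_symm htk.le hξ) z ζ
  refine ⟨(hOt 0 T (zero_add T) hT ξs (fun τ _ h => hξs τ h) x0).existsUnique, hC.ρ_pos,
    hC.ρ_lt_one, ?_⟩
  intro xs us _ Dxs hDxs R hR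
  have hDxs0 : 0 ≤ Dxs := (norm_nonneg _).trans (hDxs 0 hT.le)
  obtain ⟨hC1, hH₁, hH₂, hH₃, hH₄, hH₅⟩ := Consts.le_H2 hC hσ1 hDw hDx hD.LA_nonneg hD.LB_nonneg
    hD.LQ_nonneg hD.LP_nonneg hD.Lxbar_nonneg hD.Lw_nonneg hR.le hDxs0
  obtain ⟨H, hH⟩ : ∃ H, H = K.H2 R Dxs := ⟨_, rfl⟩
  rw [← hH] at hH₁ hH₂ hH₃ hH₄ hH₅ ⊢
  have hH1 : 1 ≤ H := hC1.trans hH₁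
  have hρ := hC.ρ_pos
  have hρ1 := hC.ρ_lt_one
  have hsum : Summable fun t => H * K.lam2 ^ t :=
    (summable_geometric_of_lt_one hρ.le hρ1).mul_left H
  have hsum' : Summable fun t => H * K.lam2 ^ (2 * t) := by
    simp only [pow_mul]
    exact (summable_geometric_of_lt_one (sq_nonneg _) (pow_lt_one₀ hρ.le hρ1 two_ne_zero)).mul_left H
  refine ⟨hH1, hsum'.tendsto_atTop_zero, hsum.tendsto_atTop_zero,
    ⟨_, le_max_left 1 _, hsum', le_max_right _ _⟩, ⟨_, le_max_left 1 _, hsum, le_max_right _ _⟩,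
    ⟨_, le_max_left 1 _, hsum, le_max_right _ _⟩, ?_, ?_, ?_, ?_⟩
  · intro t htk z _ ξ hξ ζ _ ζ' hζ'
    have hξs' : ∀ τ, t ≤ τ → τ < t + k → ξs τ ∈ D.Xi τ := fun τ _ h => hξs τ (by omega)
    refine hD.parameterBound hk le_rfl (by omega) htk.le hξ hξs' hC (hWi t htk ξ hξ)
      (hWi t htk ξs hξs') (hOi t htk ξ hξ z ζ) (hOi t htk ξs hξs' z ζ') hDw hDx (τ := R + Dxs) ?_
      hH₂ hH₃ (Or.inl ⟨rfl, ?_, by positivity⟩)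
    · have h1 := norm_le_norm_add_norm_sub' ζ' (xs (t + k))
      have h2 := mem_closedBall_iff_norm.1 hζ'
      have h3 := hDxs (t + k) htk.le
      linarith
    · gcongr
  · intro t L htL hL _ z _ ξ hξ
    have hξs' : ∀ τ, t ≤ τ → τ ≤ T → ξs τ ∈ D.Xi τ := fun τ _ h => hξs τ h
    refine hD.parameterBound hL (by omega) le_rfl htL.le (fun τ h1 h2 => hξ τ h1 (by omega))
      (fun τ h1 h2 => hξs' τ h1 (by omega)) hC (hWt t L htL hL ξ hξ) (hWt t L htL hL ξs hξs')
      (hOt t L htL hL ξ hξ z) (hOt t L htL hL ξs hξs' z) hDw hDx (τ := R + Dxs) ?_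
      hH₂ hH₃ (Or.inr ⟨rfl, rfl, rfl, hξ T (by omega) le_rfl, hξs T le_rfl, hH₄, hH₅⟩)
    rw [norm_zero]
    positivity
  · intro t htk z _ z' _ ζ _
    have hξs' : ∀ τ, t ≤ τ → τ < t + k → ξs τ ∈ D.Xi τ := fun τ _ h => hξs τ (by omega)
    exact LTV.initialStateBound_of_optimalKKT (hWi t htk ξs hξs') hC hH₁
      (hOi t htk ξs hξs' z ζ) (hOi t htk ξs hξs' z' ζ)
  · intro t L htL hL z _ z' _
    have hξs' : ∀ τ, t ≤ τ → τ ≤ T → ξs τ ∈ D.Xi τ := fun τ _ h => hξs τ h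
    exact LTV.initialStateBound_of_optimalKKT (hWt t L htL hL ξs hξs') hC hH₁
      (hOt t L htL hL ξs hξs' z) (hOt t L htL hL ξs hξs' z')
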